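/- Let $\mathcal M_{\mathbb Q}$ be the monoid (under composition) of all increasing maps $s\colon\mathbb Q\to\mathbb Q$ (i.e. $x\le y\Rightarrow s(x)\le s(y)$), let $\mathcal G_{\mathbb Q}=\mathrm{Aut}(\mathbb Q,\le)\subseteq\mathcal M_{\mathbb Q}$, and let $\mathcal T_{pw}$ be the topology of pointwise convergence on $\mathcal G_{\mathbb Q}$ (with $\mathbb Q$ discrete). All intervals below consist of rational points. The rich topology $\mathcal T_{rich}$ on $\mathcal M_{\mathbb Q}$ is generated by the following sets: * $\{s: s(x)=y\}$ for $x,y\in\mathbb Q$; * $\{s: s(I)\subseteq J\}$ for $I=(-\infty,p)$, $J\in\{(-\infty,q],(-\infty,q)\}$ and for $I=(p,+\infty)$, $J\in\{[q,+\infty),(q,+\infty)\}$, where $p,q\in\mathbb Q$; * the four boundedness classes $O_{L,U}=\{s:\inf \mathrm{Im}(s)\in L,\ \sup\mathrm{Im}(s)\in U\}$ with $L\in\{\mathbb R,\{-\infty\}\}$ and $U\in\{\mathbb R,\{+\infty\}\}$; * $\{s:\mathrm{Im}(s)\cap K=\emptyset\}$ for $K\in\{[q_1,q_2],[q_1,q_2),(q_1,q_2],(q_1,q_2)\}$,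 where $q_1\le q_2$ in $\mathbb Q\cup\{\pm\infty\}$. Let $S$ be a monoid with a topology $\mathcal T$, let $D\subseteq S$ carry a topology $\mathcal T_D$, and let $m\ge1$. Then $(S,\mathcal T)$ has *Pseudo-Property $\overline{\mathbf X}$ of length $m$* with respect to $(D,\mathcal T_D)$ if for every $s\in S$ there are $e_s,h_s^{(1)},\dots,h_s^{(m+1)}\in S$ and $a_s^{(1)},\dots,a_s^{(m)}\in D$ such that (i) $pe_s=1_S$ for some $p\in S$; (ii) $e_ss=h_s^{(m+1)}a_s^{(m)}h_s^{(m)}\cdots a_s^{(1)}h_s^{(1)}$; (iii) for all $V^{(i)}\in\mathcal T_D$ with $a_s^{(i)}\in V^{(i)}$ $(1\le i\le m)$ there is $O\in\mathcal T$ with $s\in O$ and $e_sO\subseteq h_s^{(m+1)}V^{(m)}h_s^{(m)}\cdots V^{(1)}h_s^{(1)}$. For $s\in\mathcal M_{\mathbb Q}$, let $\mathrm{Dc}^{\mathbb I}(s)$ be the set of irrational $\gamma$ with $\sup s(-\infty,\gamma)<\inf s(\gamma,+\infty)$, and let $\mathrm{LP}(s)$ be the set of limit points in $\mathbb R$ of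 $\mathrm{Im}(s)$. A *generic surjection* is a surjective $f\in\mathcal M_{\mathbb Q}$ such that each fibre $f^{-1}\{q\}$, $q\in\mathbb Q$, is an interval $(r,t)$ with $r,t$ irrational. A *generic injection* is an injective $g\in O_{\{-\infty\},\{+\infty\}}$ with $\mathrm{Dc}^{\mathbb I}(g)=\emptyset$ and $\mathrm{LP}(g)\subseteq\mathbb R\setminus\mathbb Q$. A *sparse injection* is an injective $h\in\mathcal M_{\mathbb Q}$ with $\mathrm{Dc}^{\mathbb I}(h)$ dense in $\mathbb R$ and $\mathrm{LP}(h)\subseteq\mathbb R\setminus\mathbb Q$. **Proposition.** $(\mathcal M_{\mathbb Q},\mathcal T_{rich})$ has Pseudo-Property $\overline{\mathbf X}$ of length $2$ with respect to $(\mathcal G_{\mathbb Q},\mathcal T_{pw})$. More concretely, there are a left-invertible generic injection $e$, a generic surjection $f$ and a generic injection $g$ in $\mathcal M_{\mathbb Q}$, and for each of the four boundedness classes $O_{L,U}$ a sparse injection $h\in O_{L,U}$, such that for every $s\in O_{L,U}$ there are $a,b\in\mathcal G_{\mathbb Q}$ with $$es=f\,a\,h\,b\,g,$$ and such that for all $\mathcal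 T_{pw}$-open $V,W\subseteq\mathcal G_{\mathbb Q}$ with $a\in V$ and $b\in W$ there is a $\mathcal T_{rich}$-open $O\ni s$ for which every $t\in O$ satisfies $et=f\,a'\,h\,b'\,g$ for some $a'\in V$ and $b'\in W$. -/

import Mathlib

open scoped Topology

/-- `altProd m h a` is the alternating product `h⁽ᵐ⁺¹⁾ a⁽ᵐ⁾ h⁽ᵐ⁾ ⋯ a⁽¹⁾ h⁽¹⁾`
(with indices shifted so that they start at `0`). -/
def altProd {S : Type*} [Monoid S] : (m : ℕ) → (Fin (m + 1) → S) → (Fin m → S) → S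
  | 0, h, _ => h 0
  | m + 1, h, a =>
      h (Fin.last (m + 1)) * a (Fin.last m) *
        altProd m (fun i => h i.castSucc) (fun i => a i.castSucc)

/-- Pseudo-Property `X̄` of length `m ≥ 1` of a monoid `S` with a topology `T` (no compatibility of
`T` with the multiplication is required), with respect to a subset `D` of `S` with its own
topology `TD`. -/
def HasPseudoPropertyXBar {S : Type*} [Monoid S] (T : TopologicalSpace S)
    (D : Set S) (TD : TopologicalSpace D) (m : ℕ) : Prop :=
  1 ≤ m ∧
  ∀ s : S, ∃ (e : S) (h : Fin (m + 1) → S) (a : Fin m → D),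
    (∃ p : S, p * e = 1) ∧
    e * s = altProd m h (fun i => (a i : S)) ∧
    ∀ V : Fin m → Set D, (∀ i, IsOpen[TD] (V i)) → (∀ i, a i ∈ V i) →
      ∃ U : Set S, IsOpen[T] U ∧ s ∈ U ∧
        (fun u => e * u) '' U ⊆
          {t : S | ∃ v : Fin m → D, (∀ i, v i ∈ V i) ∧ t = altProd m h (fun i => (v i : S))}

/-- The monoid of all increasing maps `ℚ → ℚ`; multiplication is composition. -/
abbrev MQ : Type := ℚ →o ℚ

/-- The automorphisms of `(ℚ, ≤)`, as a subset of `MQ`. -/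
def GQ : Set MQ := Set.range (fun a : ℚ ≃o ℚ => (a : ℚ →o ℚ))

/-- The pointwise topology on `MQ`, i.e. the subspace topology of the product topology on `ℚ → ℚ`
with discrete factors: the coarsest topology for which all evaluations `s ↦ s x` into the discrete
space `ℚ` are continuous. -/
@[reducible] def pointwiseMQ : TopologicalSpace MQ :=
  ⨅ x : ℚ, TopologicalSpace.induced (fun s : MQ => s x) ⊥

/-- The pointwise topology on the automorphisms. -/
@[reducible] def pointwiseGQ : TopologicalSpace GQ :=
  TopologicalSpace.induced (Subtype.val : GQ → MQ) pointwiseMQ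

/-- `{s | s(x) = y}` -/
def pointSet (x y : ℚ) : Set MQ := {s | s x = y}

/-- `{s | s(I) ⊆ J}` -/
def imageSet (I J : Set ℚ) : Set MQ := {s | s '' I ⊆ J}

/-- `inf Im(s)`, in `ℝ ∪ {±∞}` -/
noncomputable def infIm (s : MQ) : EReal := ⨅ x : ℚ, ((s x : ℝ) : EReal)

/-- `sup Im(s)`, in `ℝ ∪ {±∞}` -/
noncomputable def supIm (s : MQ) : EReal := ⨆ x : ℚ, ((s x : ℝ) : EReal)

/-- The subset `ℝ` of `ℝ ∪ {±∞}`. -/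
def finiteReals : Set EReal := Set.range Real.toEReal

/-- The boundedness class `{s | inf Im(s) ∈ L, sup Im(s) ∈ U}`. -/
def boundednessSet (L U : Set EReal) : Set MQ := {s | infIm s ∈ L ∧ supIm s ∈ U}

/-- `L` is one of `ℝ`, `{-∞}` and `U` is one of `ℝ`, `{+∞}`. -/
def IsBoundednessType (L U : Set EReal) : Prop :=
  (L = finiteReals ∨ L = {⊥}) ∧ (U = finiteReals ∨ U = {⊤})

/-- `{s | Im(s) ∩ K = ∅}` -/
def avoidSet (K : Set ℚ) : Set MQ := {s | Set.range s ∩ K = ∅}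

/-- The inclusion of `ℚ` into `ℚ ∪ {±∞}`. -/
def ratExt (x : ℚ) : WithBot (WithTop ℚ) := ((x : WithTop ℚ) : WithBot (WithTop ℚ))

/-- `K` is the set of rational points of an interval (closed, open or half-open) with endpoints
`q₁ ≤ q₂` in `ℚ ∪ {±∞}`. -/
def IsRationalInterval (K : Set ℚ) : Prop :=
  ∃ q₁ q₂ : WithBot (WithTop ℚ), q₁ ≤ q₂ ∧
    (K = ratExt ⁻¹' Set.Icc q₁ q₂ ∨ K = ratExt ⁻¹' Set.Ico q₁ q₂ ∨
      K = ratExt ⁻¹' Set.Ioc q₁ q₂ ∨ K = ratExt ⁻¹' Set.Ioo q₁ q₂)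

/-- The rich topology on `MQ`. -/
@[reducible] def richTopology : TopologicalSpace MQ :=
  TopologicalSpace.generateFrom
    ({O | ∃ x y : ℚ, O = pointSet x y} ∪
     {O | ∃ p q : ℚ, O = imageSet (Set.Iio p) (Set.Iic q) ∨ O = imageSet (Set.Iio p) (Set.Iio q)} ∪
     {O | ∃ p q : ℚ, O = imageSet (Set.Ioi p) (Set.Ici q) ∨ O = imageSet (Set.Ioi p) (Set.Ioi q)} ∪
     {O | ∃ L U : Set EReal, IsBoundednessType L U ∧ O = boundednessSet L U} ∪
     {O | ∃ K : Set ℚ, IsRationalInterval K ∧ O = avoidSet K})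

/-- `sup s(-∞, γ)`; the set is nonempty and bounded above for every real `γ`. -/
noncomputable def leftSup (s : MQ) (γ : ℝ) : ℝ :=
  sSup ((fun q : ℚ => (s q : ℝ)) '' {q | (q : ℝ) < γ})

/-- `inf s(γ, +∞)`; the set is nonempty and bounded below for every real `γ`. -/
noncomputable def rightInf (s : MQ) (γ : ℝ) : ℝ :=
  sInf ((fun q : ℚ => (s q : ℝ)) '' {q | γ < (q : ℝ)})

/-- The irrational discontinuity points of `s`. -/
def irrDiscont (s : MQ) : Set ℝ := {γ | Irrational γ ∧ leftSup s γ < rightInf s γ}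

/-- The limit points in `ℝ` of the image of `s`. -/
def limitPoints (s : MQ) : Set ℝ := derivedSet (Set.range (fun q : ℚ => (s q : ℝ)))

/-- Generic surjections: every fibre consists of the rational points of an open interval with
irrational endpoints. -/
def IsGenericSurjection (f : MQ) : Prop :=
  Function.Surjective f ∧
  ∀ q : ℚ, ∃ r t : ℝ, Irrational r ∧ Irrational t ∧ f ⁻¹' {q} = {x : ℚ | r < x ∧ (x : ℝ) < t}

/-- Generic injections. -/
def IsGenericInjection (g : MQ) : Prop :=
  Function.Injective g ∧ g ∈ boundednessSet {⊥} {⊤} ∧ irrDiscont g = ∅ ∧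
    limitPoints g ⊆ {γ | Irrational γ}

/-- Sparse injections. -/
def IsSparseInjection (h : MQ) : Prop :=
  Function.Injective h ∧ Dense (irrDiscont h) ∧ limitPoints h ⊆ {γ | Irrational γ}

/-! Let `f` be the projection and `g` the zero section of ℚ ×ₗ ℚ ≅ ℚ, and let `e = g`. With τ = `g ∘
s` and `k = h ∘ b ∘ g`, the equation to solve is `f ∘ a ∘ k = τ`. Call an irrational cut a gap of a
map if some rational lies strictly between the images of its two sides.

Back-and-forth solves this for `a` once `k` and τ have the same gaps and are bounded on the same
sides (`exists_automorphism_comp_eq`): the fibres of `f` have no endpoints and the image of `k` has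
no rational limit point, so only irrational cuts and the two ends can obstruct. Boundedness is
settled by the choice of `h`. For the gaps, the real extension of `b` maps onto the gaps of `h` a
countable dense set of irrationals: the images under `g` of the gaps of τ, and points in holes of
the image of `g`, which create no gap (`exists_automorphism_gaps_eq`).

For the neighbourhoods, finitely many values of `a` and `b` must be kept while `s` varies. Keeping
`a y` asks that `g ∘ t` lie on the correct sides of `f (a y)` along the cut made by `y` in `k`.
Either finitely many values of `b` determine this cut and it is rational, which gives a rich-open
condition on `t`, or it is a gap of τ (`exists_isRationalCut_or_gap`). A map `t` near `s` need not
share that gap, but it can be kept from taking values between the relevant `f (a y)`; hence it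
crosses them at a nearby cut, and the new `b'` sends this cut to the old gap of `h`
(`exists_isOpen_isCompatible`). `exists_isOpen_factorization` combines the two cases. -/

/-! ### Back-and-forth for finite order-preserving relations. -/

/-- `p` is a finite order-preserving relation contained in `R`. -/
def IsPartialIso {α β : Type*} [LinearOrder α] [LinearOrder β] (R : α → β → Prop)
    (p : Finset (α × β)) : Prop :=
  (∀ c ∈ p, R c.1 c.2) ∧ ∀ c ∈ p, ∀ d ∈ p, c.1 < d.1 ↔ c.2 < d.2

/-- Inserting a pair which is in the right position relative to all the other pairs. -/
theorem IsPartialIso.insert {α β : Type*} [LinearOrder α] [LinearOrder β] [DecidableEq (α × β)]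
    {R : α → β → Prop} {p : Finset (α × β)} (hp : IsPartialIso R p) {a : α} {b : β} (hab : R a b)
    (h : ∀ c ∈ p, (c.1 < a → c.2 < b) ∧ (a < c.1 → b < c.2))
    (hne : ∀ c ∈ p, c.1 ≠ a) :
    IsPartialIso R (insert (a, b) p) := by
  have key : ∀ c ∈ p, (c.1 < a ↔ c.2 < b) ∧ (a < c.1 ↔ b < c.2) := by
    intro c hc
    obtain ⟨h1, h2⟩ := h c hc
    refine ⟨⟨h1, fun h' => ?_⟩, ⟨h2, fun h' => ?_⟩⟩
    · exact (lt_or_gt_of_ne (hne c hc)).resolve_right fun h'' => (h2 h'').not_gt h'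
    · exact (lt_or_gt_of_ne (hne c hc)).resolve_left fun h'' => (h1 h'').not_gt h'
  constructor
  · intro c hc
    rcases Finset.mem_insert.1 hc with rfl | hc
    exacts [hab, hp.1 c hc]
  · intro c hc d hd
    rcases Finset.mem_insert.1 hc with rfl | hc <;> rcases Finset.mem_insert.1 hd with rfl | hd
    · simp
    · exact (key d hd).2
    · exact (key c hc).1
    · exact hp.2 c hc d hd

/-- The back-and-forth method for finite order-preserving relations contained in `R`. -/
theorem exists_relation_of_back_and_forth {α β : Type*} [LinearOrder α] [LinearOrder β]
    {A : Set α} {B : Set β} (hA : A.Countable) (hB : B.Countable) {R : α → β → Prop}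
    {p₀ : Finset (α × β)} (h₀ : IsPartialIso R p₀)
    (forth : ∀ p, IsPartialIso R p → ∀ a ∈ A, (∀ c ∈ p, c.1 ≠ a) →
      ∃ b, R a b ∧ ∀ c ∈ p, (c.1 < a → c.2 < b) ∧ (a < c.1 → b < c.2))
    (back : ∀ p, IsPartialIso R p → ∀ b ∈ B, (∀ c ∈ p, c.2 ≠ b) →
      ∃ a, R a b ∧ ∀ c ∈ p, (c.2 < b → c.1 < a) ∧ (b < c.2 → a < c.1)) :
    ∃ E : α → β → Prop, (∀ c ∈ p₀, E c.1 c.2) ∧ (∀ a b, E a b → R a b) ∧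
      (∀ a b a' b', E a b → E a' b' → (a < a' ↔ b < b')) ∧
      (∀ a ∈ A, ∃ b, E a b) ∧ (∀ b ∈ B, ∃ a, E a b) := by
  classical
  let P := {p : Finset (α × β) // IsPartialIso R p}
  have := hA.to_subtype
  have := hB.to_subtype
  cases nonempty_encodable A
  cases nonempty_encodable B
  -- Being defined at `a`, or taking the value `b`, is a cofinal condition. An ideal meeting these
  -- countably many cofinal sets is directed, so its union is still order-preserving.
  let D : A ⊕ B → Order.Cofinal P := fun i => match i with
    | .inl a => ⟨{p | ∃ b, (a.1, b) ∈ p.1}, by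
        rintro ⟨p, hp⟩
        by_cases h : ∀ c ∈ p, c.1 ≠ a.1
        · obtain ⟨b, hR, hb⟩ := forth p hp a.1 a.2 h
          exact ⟨⟨_, hp.insert hR hb h⟩, ⟨b, Finset.mem_insert_self _ _⟩,
            Finset.subset_insert _ _⟩
        · push Not at h
          obtain ⟨c, hc, h'⟩ := h
          exact ⟨⟨p, hp⟩, ⟨c.2, by simpa [← h'] using hc⟩, le_rfl⟩⟩
    | .inr b => ⟨{p | ∃ a, (a, b.1) ∈ p.1}, by
        rintro ⟨p, hp⟩
        by_cases h : ∀ c ∈ p, c.2 ≠ b.1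
        · obtain ⟨a, hR, ha⟩ := back p hp b.1 b.2 h
          refine ⟨⟨_, hp.insert hR (fun c hc => ⟨fun h' => ?_, fun h' => ?_⟩) fun c hc h' => ?_⟩,
            ⟨a, Finset.mem_insert_self _ _⟩, Finset.subset_insert _ _⟩
          · exact (lt_or_gt_of_ne (h c hc)).resolve_right fun h'' => ((ha c hc).2 h'').not_gt h'
          · exact (lt_or_gt_of_ne (h c hc)).resolve_left fun h'' => ((ha c hc).1 h'').not_gt h'
          · rcases lt_or_gt_of_ne (h c hc) with h'' | h''
            exacts [((ha c hc).1 h'').ne h', ((ha c hc).2 h'').ne' h']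
        · push Not at h
          obtain ⟨c, hc, h'⟩ := h
          exact ⟨⟨p, hp⟩, ⟨c.1, by simpa [← h'] using hc⟩, le_rfl⟩⟩
  let I := Order.idealOfCofinals (⟨p₀, h₀⟩ : P) D
  refine ⟨fun a b => ∃ p ∈ I, (a, b) ∈ p.1,
    fun c hc => ⟨_, Order.mem_idealOfCofinals _ D, hc⟩, ?_, ?_, ?_, ?_⟩
  · rintro a b ⟨p, -, hp⟩
    exact p.2.1 _ hp
  · rintro a b a' b' ⟨p, hpI, hp⟩ ⟨q, hqI, hq⟩
    obtain ⟨r, -, hpr, hqr⟩ := I.directed _ hpI _ hqI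
    exact r.2.2 _ (hpr hp) _ (hqr hq)
  · intro a ha
    obtain ⟨p, ⟨b, hb⟩, hp⟩ := Order.cofinal_meets_idealOfCofinals (⟨p₀, h₀⟩ : P) D (.inl ⟨a, ha⟩)
    exact ⟨b, p, hp, hb⟩
  · intro b hb
    obtain ⟨p, ⟨a, ha⟩, hp⟩ := Order.cofinal_meets_idealOfCofinals (⟨p₀, h₀⟩ : P) D (.inr ⟨b, hb⟩)
    exact ⟨a, p, hp, ha⟩

/-- A total order-preserving relation is the graph of an order isomorphism. -/
theorem exists_orderIso_of_relation {α β : Type*} [LinearOrder α] [LinearOrder β]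
    {E : α → β → Prop} (hE : ∀ a b a' b', E a b → E a' b' → (a < a' ↔ b < b'))
    (hl : ∀ a, ∃ b, E a b) (hr : ∀ b, ∃ a, E a b) :
    ∃ F : α ≃o β, ∀ a, E a (F a) := by
  choose F hF using hl
  have hmono : StrictMono F := fun a a' h => (hE _ _ _ _ (hF a) (hF a')).1 h
  refine ⟨hmono.orderIsoOfSurjective F fun b => ?_, hF⟩
  obtain ⟨a, ha⟩ := hr b
  refine ⟨a, le_antisymm ?_ ?_⟩
  · exact not_lt.1 fun h => lt_irrefl _ ((hE _ _ _ _ ha (hF a)).2 h)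
  · exact not_lt.1 fun h => lt_irrefl _ ((hE _ _ _ _ (hF a) ha).2 h)

/-! ### Cuts, isolated images and gaps. -/

/-- The cut is made by the supremum of `X`; a rational supremum would be a greatest element of `X`
or a least element of its complement. -/
theorem exists_irrational_cut {X : Set ℚ} (hX : IsLowerSet X) (hne : X.Nonempty)
    (hne' : Xᶜ.Nonempty) (hmax : ∀ x ∈ X, ∃ x' ∈ X, x < x') (hmin : ∀ x ∉ X, ∃ x' ∉ X, x' < x) :
    ∃ γ : ℝ, Irrational γ ∧ ∀ x : ℚ, x ∈ X ↔ (x : ℝ) < γ := by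
  obtain ⟨u, hu⟩ := hne'
  set S : Set ℝ := (fun x : ℚ => (x : ℝ)) '' X
  have hlt : ∀ x ∈ X, ∀ y ∉ X, x < y := fun x hx y hy => not_le.1 fun h => hy (hX h hx)
  have hub : ∀ y ∉ X, (y : ℝ) ∈ upperBounds S := by
    rintro y hy _ ⟨x, hx, rfl⟩
    exact Rat.cast_le.2 (hlt x hx y hy).le
  have hbdd : BddAbove S := ⟨u, hub u hu⟩
  have h1 : ∀ x ∈ X, (x : ℝ) < sSup S := by
    intro x hx
    obtain ⟨x', hx', h⟩ := hmax x hx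
    exact lt_of_lt_of_le (Rat.cast_lt.2 h) (le_csSup hbdd ⟨x', hx', rfl⟩)
  have h2 : ∀ y ∉ X, sSup S < (y : ℝ) := by
    intro y hy
    obtain ⟨y', hy', h⟩ := hmin y hy
    exact lt_of_le_of_lt (csSup_le (hne.image _) (hub y' hy')) (Rat.cast_lt.2 h)
  refine ⟨sSup S, ?_, fun x => ⟨h1 x, fun h => by_contra fun hx => (h2 x hx).not_gt h⟩⟩
  rintro ⟨q, hq⟩
  by_cases h : q ∈ X
  · exact (h1 q h).ne hq
  · exact (h2 q h).ne' hq

/-- This sorts the lower bounds imposed on a new value by earlier choices `L` and by the map `k` on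
`X`: there are none, or one of them is strongest, or `X` has no last element and `k` passes all of
`L` on it. In the last case only the cut `X` matters. -/
theorem isGreatest_or_cofinal {α β : Type*} [LinearOrder α] [LinearOrder β] {k : α → β}
    (hk : Monotone k) (X : Set α) (L : Finset β) :
    (X = ∅ ∧ L = ∅) ∨ (∃ m, IsGreatest (k '' X ∪ ↑L) m) ∨
      (X.Nonempty ∧ (∀ x ∈ X, ∃ x' ∈ X, x < x') ∧ ∀ l ∈ L, ∃ x ∈ X, l < k x) := by
  by_cases hX : ∃ x ∈ X, ∀ x' ∈ X, x' ≤ x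
  · obtain ⟨x, hx, hmax⟩ := hX
    right; left
    by_cases hL : L.Nonempty
    · rcases le_total (k x) (L.max' hL) with h | h
      · refine ⟨L.max' hL, Or.inr (L.max'_mem hL), ?_⟩
        rintro _ (⟨x', hx', rfl⟩ | hl)
        exacts [(hk (hmax x' hx')).trans h, L.le_max' _ hl]
      · refine ⟨k x, Or.inl ⟨x, hx, rfl⟩, ?_⟩
        rintro _ (⟨x', hx', rfl⟩ | hl)
        exacts [hk (hmax x' hx'), (L.le_max' _ hl).trans h]
    · refine ⟨k x, Or.inl ⟨x, hx, rfl⟩, ?_⟩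
      rintro _ (⟨x', hx', rfl⟩ | hl)
      exacts [hk (hmax x' hx'), (hL ⟨_, hl⟩).elim]
  · push Not at hX
    by_cases hL : L.Nonempty
    · by_cases h : ∀ x ∈ X, k x ≤ L.max' hL
      · right; left
        refine ⟨L.max' hL, Or.inr (L.max'_mem hL), ?_⟩
        rintro _ (⟨x', hx', rfl⟩ | hl)
        exacts [h x' hx', L.le_max' _ hl]
      · push Not at h
        obtain ⟨x, hx, h⟩ := h
        exact .inr (.inr ⟨⟨x, hx⟩, hX, fun l hl => ⟨x, hx, (L.le_max' _ hl).trans_lt h⟩⟩)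
    · rw [Finset.not_nonempty_iff_eq_empty] at hL
      rcases X.eq_empty_or_nonempty with h | h
      · exact .inl ⟨h, hL⟩
      · exact .inr (.inr ⟨h, hX, by simp [hL]⟩)

theorem isLeast_or_coinitial {α β : Type*} [LinearOrder α] [LinearOrder β] {k : α → β}
    (hk : Monotone k) (X : Set α) (L : Finset β) :
    (X = ∅ ∧ L = ∅) ∨ (∃ m, IsLeast (k '' X ∪ ↑L) m) ∨
      (X.Nonempty ∧ (∀ x ∈ X, ∃ x' ∈ X, x' < x) ∧ ∀ l ∈ L, ∃ x ∈ X, k x < l) :=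
  isGreatest_or_cofinal (α := αᵒᵈ) (β := βᵒᵈ) hk.dual X L

/-- No rational number is a limit point of the image of `s`. -/
def HasIsolatedImage (s : ℚ → ℚ) : Prop :=
  ∀ q, ∃ q₁ q₂, q₁ < q ∧ q < q₂ ∧ ∀ x, q₁ < s x → s x < q₂ → s x = q

/-- The irrational cuts of `ℚ` which are mapped by `s` to a cut containing a rational number. -/
def gaps (s : ℚ → ℚ) : Set ℝ :=
  {γ | Irrational γ ∧ ∃ y : ℚ, ∀ x : ℚ, ((x : ℝ) < γ → s x < y) ∧ (γ < x → y < s x)}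

/-- Separating rationals of distinct gaps are distinct, because the value at a rational between the
two gaps lies strictly between them. -/
theorem gaps_countable (s : ℚ → ℚ) : (gaps s).Countable := by
  choose! y hy using fun γ (h : γ ∈ gaps s) => h.2
  have key : ∀ γ ∈ gaps s, ∀ γ' ∈ gaps s, γ < γ' → y γ ≠ y γ' := by
    intro γ h γ' h' hlt heq
    obtain ⟨x, h1, h2⟩ := exists_rat_btwn hlt
    have := ((hy γ h x).2 h1).trans ((hy γ' h' x).1 h2)
    exact this.ne heq
  refine Set.MapsTo.countable_of_injOn (Set.mapsTo_univ y _) (fun γ h γ' h' heq => ?_)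
    (Set.to_countable _)
  rcases lt_trichotomy γ γ' with hlt | rfl | hlt
  exacts [(key γ h γ' h' hlt heq).elim, rfl, (key γ' h' γ h hlt heq.symm).elim]

theorem Irrational.lt_or_gt_rat {γ : ℝ} (h : Irrational γ) (x : ℚ) : (x : ℝ) < γ ∨ γ < x :=
  lt_or_gt_of_ne fun h' => h ⟨x, h'⟩

/-! ### Solving `f ∘ a ∘ k = τ` for the automorphism `a`. -/

/-- The pair `(y, z)` may be added to an automorphism `a` for which `f ∘ a ∘ k = τ`. -/
def IsAdmissible (f k τ : ℚ → ℚ) (y z : ℚ) : Prop :=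
  ∀ x, (k x < y → τ x ≤ f z) ∧ (y < k x → f z ≤ τ x) ∧ (k x = y → τ x = f z)

/-- Since fibres have no endpoints, the fibre of `q` contains a point above all of `L` and a point
below all of `U`. By monotonicity everything between these two points is in the fibre as well. -/
theorem exists_mem_fiber_between {f : ℚ → ℚ} (hf : Function.Surjective f)
    (hfl : ∀ z, ∃ z' < z, f z' = f z) (hfu : ∀ z, ∃ z' > z, f z' = f z) (hmono : Monotone f)
    {L U : Finset ℚ} (hLU : ∀ l ∈ L, ∀ u ∈ U, l < u) {q : ℚ} (hL : ∀ l ∈ L, f l ≤ q)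
    (hU : ∀ u ∈ U, q ≤ f u) :
    ∃ z, f z = q ∧ (∀ l ∈ L, l < z) ∧ ∀ u ∈ U, z < u := by
  classical
  have hup : ∃ z, f z = q ∧ ∀ l ∈ L, l < z := by
    clear hLU
    induction L using Finset.induction_on with
    | empty => obtain ⟨z, hz⟩ := hf q; exact ⟨z, hz, by simp⟩
    | insert a s _ ih =>
      obtain ⟨z, hz, h⟩ := ih fun l hl => hL l (Finset.mem_insert_of_mem hl)
      rcases lt_or_ge a z with h' | h'
      · exact ⟨z, hz, fun l hl => (Finset.mem_insert.1 hl).elim (fun e => e ▸ h') (h l)⟩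
      -- Here `z ≤ a` and `f a ≤ q` force `f a = q`, so one can climb past `a` inside the fibre.
      · obtain ⟨z', hz', e⟩ := hfu a
        refine ⟨z', ?_, fun l hl => (Finset.mem_insert.1 hl).elim (fun e => e ▸ hz')
          fun hl => (h l hl).trans_le (h'.trans hz'.le)⟩
        rw [e]
        exact le_antisymm (hL a (Finset.mem_insert_self _ _)) (hz ▸ hmono h')
  have hdown : ∃ z, f z = q ∧ ∀ u ∈ U, z < u := by
    clear hLU
    induction U using Finset.induction_on with
    | empty => obtain ⟨z, hz⟩ := hf q; exact ⟨z, hz, by simp⟩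
    | insert a s _ ih =>
      obtain ⟨z, hz, h⟩ := ih fun l hl => hU l (Finset.mem_insert_of_mem hl)
      rcases lt_or_ge z a with h' | h'
      · exact ⟨z, hz, fun l hl => (Finset.mem_insert.1 hl).elim (fun e => e ▸ h') (h l)⟩
      · obtain ⟨z', hz', e⟩ := hfl a
        refine ⟨z', ?_, fun l hl => (Finset.mem_insert.1 hl).elim (fun e => e ▸ hz')
          fun hl => lt_of_le_of_lt (hz'.le.trans h') (h l hl)⟩
        rw [e]
        exact le_antisymm (hz ▸ hmono h') (hU a (Finset.mem_insert_self _ _))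
  obtain ⟨u₀, hu₀, hLu⟩ := hup
  obtain ⟨l₀, hl₀, hlU⟩ := hdown
  rcases lt_or_ge l₀ u₀ with h | h
  · obtain ⟨z, hz1, hz2⟩ := Order.exists_between_finsets (insert l₀ L) (insert u₀ U) (by
      intro x hx y hy
      rcases Finset.mem_insert.1 hx with rfl | hx <;> rcases Finset.mem_insert.1 hy with rfl | hy
      exacts [h, hlU y hy, hLu x hx, hLU x hx y hy])
    refine ⟨z, le_antisymm ?_ ?_, fun l hl => hz1 l (Finset.mem_insert_of_mem hl),
      fun u hu => hz2 u (Finset.mem_insert_of_mem hu)⟩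
    · exact hu₀ ▸ hmono (hz2 u₀ (Finset.mem_insert_self _ _)).le
    · exact hl₀ ▸ hmono (hz1 l₀ (Finset.mem_insert_self _ _)).le
  · exact ⟨u₀, hu₀, hLu, fun u hu => h.trans_lt (hlU u hu)⟩

section Automorphism

variable {f k τ : ℚ → ℚ}

/-- The forth step. It suffices to find the value `q = f z`. A strongest bound on either side can
itself serve as `q`; if one side is empty, boundedness of `τ` helps. Otherwise `y` lies in a gap of
`k`, which is also a gap of `τ`. -/
theorem exists_value_of_isPartialIso (hf : Function.Surjective f)
    (hfl : ∀ z, ∃ z' < z, f z' = f z) (hfu : ∀ z, ∃ z' > z, f z' = f z) (hfm : Monotone f)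
    (hk : StrictMono k) (hτ : Monotone τ)
    (hgap : gaps k ⊆ gaps τ)
    (hlow : (∃ y, ∀ x, y < k x) → ∃ q, ∀ x, q < τ x)
    (hupp : (∃ y, ∀ x, k x < y) → ∃ q, ∀ x, τ x < q)
    {p : Finset (ℚ × ℚ)} (hp : IsPartialIso (IsAdmissible f k τ) p) {y : ℚ} :
    ∃ z, IsAdmissible f k τ y z ∧ ∀ c ∈ p, (c.1 < y → c.2 < z) ∧ (y < c.1 → z < c.2) := by
  classical
  set L := (p.filter fun c => c.1 < y).image Prod.snd with hL
  set U := (p.filter fun c => y < c.1).image Prod.snd with hU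
  have hLU : ∀ l ∈ L, ∀ u ∈ U, l < u := by
    simp only [hL, hU, Finset.mem_image, Finset.mem_filter]
    rintro _ ⟨c, ⟨hc, hcy⟩, rfl⟩ _ ⟨d, ⟨hd, hdy⟩, rfl⟩
    exact (hp.2 c hc d hd).1 (hcy.trans hdy)
  have hL1 : ∀ l ∈ L, ∀ x, y ≤ k x → f l ≤ τ x := by
    simp only [hL, Finset.mem_image, Finset.mem_filter]
    rintro _ ⟨c, ⟨hc, hcy⟩, rfl⟩ x hx
    exact (hp.1 c hc x).2.1 (hcy.trans_le hx)
  have hU1 : ∀ u ∈ U, ∀ x, k x ≤ y → τ x ≤ f u := by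
    simp only [hU, Finset.mem_image, Finset.mem_filter]
    rintro _ ⟨c, ⟨hc, hcy⟩, rfl⟩ x hx
    exact (hp.1 c hc x).1 (hx.trans_lt hcy)
  suffices h : ∃ q, (∀ x, (k x < y → τ x ≤ q) ∧ (y < k x → q ≤ τ x) ∧ (k x = y → τ x = q)) ∧
      (∀ l ∈ L, f l ≤ q) ∧ ∀ u ∈ U, q ≤ f u by
    obtain ⟨q, hq, hqL, hqU⟩ := h
    obtain ⟨z, rfl, hz1, hz2⟩ := exists_mem_fiber_between hf hfl hfu hfm hLU hqL hqU
    refine ⟨z, hq, fun c hc => ⟨fun h => hz1 _ ?_, fun h => hz2 _ ?_⟩⟩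
    · exact Finset.mem_image_of_mem _ (Finset.mem_filter.2 ⟨hc, h⟩)
    · exact Finset.mem_image_of_mem _ (Finset.mem_filter.2 ⟨hc, h⟩)
  by_cases hy : ∃ x, k x = y
  · obtain ⟨x, rfl⟩ := hy
    refine ⟨τ x, fun x' => ⟨fun h => ?_, fun h => ?_, fun h => ?_⟩, fun l hl => hL1 l hl x le_rfl,
      fun u hu => hU1 u hu x le_rfl⟩
    · exact hτ (hk.lt_iff_lt.1 h).le
    · exact hτ (hk.lt_iff_lt.1 h).le
    · rw [hk.injective h]
  suffices h : ∃ q, (∀ x, k x < y → τ x ≤ q) ∧ (∀ x, y < k x → q ≤ τ x) ∧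
      (∀ l ∈ L, f l ≤ q) ∧ ∀ u ∈ U, q ≤ f u by
    obtain ⟨q, h1, h2, h3, h4⟩ := h
    exact ⟨q, fun x => ⟨h1 x, h2 x, fun h => (hy ⟨x, h⟩).elim⟩, h3, h4⟩
  have hne : ∀ x, k x < y ∨ y < k x := fun x => lt_or_gt_of_ne fun h => hy ⟨x, h⟩
  have hleft : ∀ a ∈ τ '' {x | k x < y} ∪ ↑(L.image f),
      (∀ x, y < k x → a ≤ τ x) ∧ ∀ u ∈ U, a ≤ f u := by
    rintro a (⟨x, hx, rfl⟩ | ha)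
    · exact ⟨fun x' hx' => hτ (hk.lt_iff_lt.1 (lt_trans hx hx')).le,
        fun u hu => hU1 u hu x (le_of_lt hx)⟩
    · obtain ⟨l, hl, rfl⟩ := Finset.mem_image.1 (Finset.mem_coe.1 ha)
      exact ⟨fun x' hx' => hL1 l hl x' hx'.le, fun u hu => hfm (hLU l hl u hu).le⟩
  have hright : ∀ a ∈ τ '' {x | y < k x} ∪ ↑(U.image f),
      (∀ x, k x < y → τ x ≤ a) ∧ ∀ l ∈ L, f l ≤ a := by
    rintro a (⟨x, hx, rfl⟩ | ha)
    · exact ⟨fun x' hx' => hτ (hk.lt_iff_lt.1 (lt_trans hx' hx)).le,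
        fun u hu => hL1 u hu x (le_of_lt hx)⟩
    · obtain ⟨l, hl, rfl⟩ := Finset.mem_image.1 (Finset.mem_coe.1 ha)
      exact ⟨fun x' hx' => hU1 l hl x' hx'.le, fun u hu => hfm (hLU u hu l hl).le⟩
  rcases isGreatest_or_cofinal hτ {x | k x < y} (L.image f) with ⟨hX, hLe⟩ | ⟨m, hm⟩ | hcl
  · obtain ⟨q, hq⟩ := hlow ⟨y, fun x => (hne x).resolve_left fun h =>
      Set.notMem_empty x (hX ▸ h)⟩
    have hLe' : L = ∅ := by simpa using hLe
    obtain ⟨q', hq'⟩ := (U.image f).bddBelow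
    refine ⟨min q q', fun x h => (Set.notMem_empty x (hX ▸ h)).elim,
      fun x _ => (min_le_left _ _).trans (hq x).le, by simp [hLe'],
      fun u hu => (min_le_right _ _).trans (hq' (Finset.mem_image_of_mem _ hu))⟩
  · exact ⟨m, fun x h => hm.2 (.inl ⟨x, h, rfl⟩), (hleft m hm.1).1,
      fun l hl => hm.2 (.inr (Finset.mem_image_of_mem _ hl)), (hleft m hm.1).2⟩
  rcases isLeast_or_coinitial hτ {x | y < k x} (U.image f) with ⟨hX, hUe⟩ | ⟨m, hm⟩ | hcu
  · obtain ⟨q, hq⟩ := hupp ⟨y, fun x => (hne x).resolve_right fun h =>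
      Set.notMem_empty x (hX ▸ h)⟩
    have hUe' : U = ∅ := by simpa using hUe
    obtain ⟨q', hq'⟩ := (L.image f).bddAbove
    refine ⟨max q q', fun x _ => (hq x).le.trans (le_max_left _ _),
      fun x h => (Set.notMem_empty x (hX ▸ h)).elim,
      fun u hu => (hq' (Finset.mem_image_of_mem _ hu)).trans (le_max_right _ _), by simp [hUe']⟩
  · exact ⟨m, (hright m hm.1).1, fun x h => hm.2 (.inl ⟨x, h, rfl⟩), (hright m hm.1).2,
      fun l hl => hm.2 (.inr (Finset.mem_image_of_mem _ hl))⟩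
  obtain ⟨hXne, hXmax, hXL⟩ := hcl
  obtain ⟨hYne, hYmin, hYU⟩ := hcu
  have hcompl : ∀ x, x ∉ {x | k x < y} ↔ x ∈ {x | y < k x} := fun x =>
    ⟨fun h => (hne x).resolve_left h, fun h h' => lt_asymm (α := ℚ) h h'⟩
  -- Neither side of the cut made by `y` has an extremal element, so the cut is irrational and `y`
  -- witnesses a gap of `k`.
  obtain ⟨γ, hγ, hγX⟩ := exists_irrational_cut (X := {x | k x < y})
    (fun a b hba ha => (hk.monotone hba).trans_lt ha) hXne
    (hYne.mono fun x hx => (hcompl x).2 hx) hXmax (fun x hx => by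
      obtain ⟨x', hx', h⟩ := hYmin x ((hcompl x).1 hx)
      exact ⟨x', (hcompl x').2 hx', h⟩)
  have hγY : ∀ x : ℚ, y < k x → γ < x := fun x hx =>
    (hγ.lt_or_gt_rat x).resolve_left fun h => (hcompl x).2 hx ((hγX x).2 h)
  obtain ⟨-, q, hq⟩ := hgap ⟨hγ, y, fun x => ⟨(hγX x).2, fun h =>
    (hcompl x).1 fun h' => h.not_gt ((hγX x).1 h')⟩⟩
  refine ⟨q, fun x h => ((hq x).1 ((hγX x).1 h)).le, fun x h => ((hq x).2 (hγY x h)).le,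
    fun l hl => ?_, fun u hu => ?_⟩
  · obtain ⟨x, hx, h⟩ := hXL (f l) (Finset.mem_image_of_mem _ hl)
    exact (h.trans ((hq x).1 ((hγX x).1 hx))).le
  · obtain ⟨x, hx, h⟩ := hYU (f u) (Finset.mem_image_of_mem _ hu)
    exact (((hq x).2 (hγY x hx)).trans h).le

/-- The back step. If no `k x` with `τ x = f z` fits between `L` and `U`, then `y` has to avoid the
image of `k`. Next to a strongest bound there is room because the image is isolated; at an
irrational cut the room comes from a gap of `τ`. -/
theorem exists_argument_of_isPartialIso (hfm : Monotone f)
    (hk : StrictMono k) (hki : HasIsolatedImage k) (hτ : Monotone τ)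
    (hgap : gaps τ ⊆ gaps k)
    (hlow : (∃ q, ∀ x, q < τ x) → ∃ y, ∀ x, y < k x)
    (hupp : (∃ q, ∀ x, τ x < q) → ∃ y, ∀ x, k x < y)
    {p : Finset (ℚ × ℚ)} (hp : IsPartialIso (IsAdmissible f k τ) p) {z : ℚ} :
    ∃ y, IsAdmissible f k τ y z ∧ ∀ c ∈ p, (c.2 < z → c.1 < y) ∧ (z < c.2 → y < c.1) := by
  classical
  set L := (p.filter fun c => c.2 < z).image Prod.fst with hL
  set U := (p.filter fun c => z < c.2).image Prod.fst with hU
  have hLU : ∀ l ∈ L, ∀ u ∈ U, l < u := by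
    simp only [hL, hU, Finset.mem_image, Finset.mem_filter]
    rintro _ ⟨c, ⟨hc, hcy⟩, rfl⟩ _ ⟨d, ⟨hd, hdy⟩, rfl⟩
    exact (hp.2 c hc d hd).2 (hcy.trans hdy)
  have hL1 : ∀ l ∈ L, ∀ x, k x ≤ l → τ x ≤ f z := by
    simp only [hL, Finset.mem_image, Finset.mem_filter]
    rintro _ ⟨c, ⟨hc, hcz⟩, rfl⟩ x hx
    have := hp.1 c hc x
    refine le_trans ?_ (hfm hcz.le)
    rcases hx.lt_or_eq with h | h
    exacts [this.1 h, (this.2.2 h).le]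
  have hU1 : ∀ u ∈ U, ∀ x, u ≤ k x → f z ≤ τ x := by
    simp only [hU, Finset.mem_image, Finset.mem_filter]
    rintro _ ⟨c, ⟨hc, hcz⟩, rfl⟩ x hx
    have := hp.1 c hc x
    refine (hfm hcz.le).trans ?_
    rcases hx.lt_or_eq with h | h
    exacts [this.2.1 h, (this.2.2 h.symm).ge]
  suffices h : ∃ y, IsAdmissible f k τ y z ∧ (∀ l ∈ L, l < y) ∧ ∀ u ∈ U, y < u by
    obtain ⟨y, hy, h1, h2⟩ := h
    refine ⟨y, hy, fun c hc => ⟨fun h => h1 _ ?_, fun h => h2 _ ?_⟩⟩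
    · exact Finset.mem_image_of_mem _ (Finset.mem_filter.2 ⟨hc, h⟩)
    · exact Finset.mem_image_of_mem _ (Finset.mem_filter.2 ⟨hc, h⟩)
  by_cases hex : ∃ x, τ x = f z ∧ (∀ l ∈ L, l < k x) ∧ ∀ u ∈ U, k x < u
  · obtain ⟨x, hx, h1, h2⟩ := hex
    refine ⟨k x, fun x' => ⟨fun h => ?_, fun h => ?_, fun h => ?_⟩, h1, h2⟩
    · exact hx ▸ hτ (hk.lt_iff_lt.1 h).le
    · exact hx ▸ hτ (hk.lt_iff_lt.1 h).le
    · rw [hk.injective h, hx]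
  -- Points with `τ x = f z` are forced to one side by `L` or `U`, so `X` and `Y` are complementary.
  set X : Set ℚ := {x | τ x < f z ∨ ∃ l ∈ L, k x ≤ l} with hX
  set Y : Set ℚ := {x | f z < τ x ∨ ∃ u ∈ U, u ≤ k x} with hY
  have hXY : ∀ x, x ∉ X ↔ x ∈ Y := by
    intro x
    constructor
    · intro h
      simp only [hX, Set.mem_ofPred_eq, not_or, not_lt, not_exists, not_and, not_le] at h
      rcases h.1.lt_or_eq with h' | h'
      · exact .inl h'
      · right
        by_contra! h''
        exact hex ⟨x, h'.symm, h.2, h''⟩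
    · rintro (h | ⟨u, hu, h⟩) (h' | ⟨l, hl, h'⟩)
      · exact h.not_gt h'
      · exact (hL1 l hl x h').not_gt h
      · exact (hU1 u hu x h).not_gt h'
      · exact (h.trans h').not_gt (hLU l hl u hu)
  have hXle : ∀ x ∈ X, τ x ≤ f z := by
    rintro x (h | ⟨l, hl, h⟩)
    exacts [h.le, hL1 l hl x h]
  have hYge : ∀ x ∈ Y, f z ≤ τ x := by
    rintro x (h | ⟨u, hu, h⟩)
    exacts [h.le, hU1 u hu x h]
  have hXlow : IsLowerSet X := by
    rintro x x' hxx (h | ⟨l, hl, h⟩)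
    exacts [.inl ((hτ hxx).trans_lt h), .inr ⟨l, hl, (hk.monotone hxx).trans h⟩]
  have hlt : ∀ x ∈ X, ∀ x' ∈ Y, x < x' := fun x hx x' hx' =>
    not_le.1 fun h => (hXY x').2 hx' (hXlow h hx)
  suffices h : ∃ y, (∀ x ∈ X, k x < y) ∧ (∀ x ∈ Y, y < k x) ∧
      (∀ l ∈ L, l < y) ∧ ∀ u ∈ U, y < u by
    obtain ⟨y, h1, h2, h3, h4⟩ := h
    refine ⟨y, fun x => ?_, h3, h4⟩
    by_cases hx : x ∈ X
    · have := h1 x hx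
      exact ⟨fun _ => hXle x hx, fun h => (h.not_gt this).elim, fun h => (this.ne h).elim⟩
    · rw [hXY] at hx
      have := h2 x hx
      exact ⟨fun h => (h.not_gt this).elim, fun _ => hYge x hx, fun h => (this.ne' h).elim⟩
  have hleft : ∀ a ∈ k '' X ∪ ↑L, (∀ x ∈ Y, a < k x) ∧ ∀ u ∈ U, a < u := by
    rintro a (⟨x, hx, rfl⟩ | ha)
    · refine ⟨fun x' hx' => hk (hlt x hx x' hx'), fun u hu => not_le.1 fun h => ?_⟩
      exact (hXY x).2 (.inr ⟨u, hu, h⟩) hx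
    · exact ⟨fun x' hx' => not_le.1 fun h => (hXY x').2 hx' (.inr ⟨a, ha, h⟩), hLU a ha⟩
  have hright : ∀ a ∈ k '' Y ∪ ↑U, (∀ x ∈ X, k x < a) ∧ ∀ l ∈ L, l < a := by
    rintro a (⟨x, hx, rfl⟩ | ha)
    · refine ⟨fun x' hx' => hk (hlt x' hx' x hx), fun l hl => not_le.1 fun h => ?_⟩
      exact (hXY x).2 hx (.inr ⟨l, hl, h⟩)
    · exact ⟨fun x' hx' => not_le.1 fun h => (hXY x').2 (.inr ⟨a, ha, h⟩) hx',
        fun l hl => hLU l hl a ha⟩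
  rcases isGreatest_or_cofinal hk.monotone X L with ⟨hX0, hLe⟩ | ⟨m, hm⟩ | hcl
  · have hall : ∀ x, x ∈ Y := fun x => (hXY x).1 (hX0 ▸ Set.notMem_empty x)
    obtain ⟨y, hy⟩ := hlow ⟨f z - 1, fun x => (sub_one_lt _).trans_le (hYge x (hall x))⟩
    obtain ⟨y', hy'⟩ := U.bddBelow
    refine ⟨min y (y' - 1), by simp [hX0], fun x _ => (min_le_left _ _).trans_lt (hy x),
      by simp [hLe], fun u hu => (min_le_right _ _).trans_lt ((sub_one_lt _).trans_le (hy' hu))⟩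
  -- By isolation no value of `k` lies strictly between `m` and `q₂`, so `y` may be placed there.
  · obtain ⟨q₁, q₂, hq₁, hq₂, hq⟩ := hki m
    obtain ⟨y, hy1, hy2⟩ := Order.exists_between_finsets {m} (insert q₂ U) (by
      simpa [hq₂] using (hleft m hm.1).2)
    have hmy : m < y := hy1 m (by simp)
    refine ⟨y, fun x hx => (hm.2 (.inl ⟨x, hx, rfl⟩)).trans_lt hmy, fun x hx => ?_,
      fun l hl => (hm.2 (.inr hl)).trans_lt hmy, fun u hu => hy2 u (Finset.mem_insert_of_mem hu)⟩
    have h1 := (hleft m hm.1).1 x hx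
    by_contra! h
    refine h1.ne' (hq x (hq₁.trans h1) (h.trans_lt (hy2 q₂ (Finset.mem_insert_self _ _))))
  rcases isLeast_or_coinitial hk.monotone Y U with ⟨hY0, hUe⟩ | ⟨m, hm⟩ | hcu
  · have hall : ∀ x, x ∈ X := fun x => by_contra fun h =>
      Set.notMem_empty x (hY0 ▸ (hXY x).1 h)
    obtain ⟨y, hy⟩ := hupp ⟨f z + 1, fun x => (hXle x (hall x)).trans_lt (lt_add_one _)⟩
    obtain ⟨y', hy'⟩ := L.bddAbove
    refine ⟨max y (y' + 1), fun x _ => (hy x).trans_le (le_max_left _ _), by simp [hY0],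
      fun l hl => ((hy' hl).trans_lt (lt_add_one _)).trans_le (le_max_right _ _), by simp [hUe]⟩
  · obtain ⟨q₁, q₂, hq₁, hq₂, hq⟩ := hki m
    obtain ⟨y, hy1, hy2⟩ := Order.exists_between_finsets (insert q₁ L) {m} (by
      simpa [hq₁] using (hright m hm.1).2)
    have hmy : y < m := hy2 m (by simp)
    refine ⟨y, fun x hx => ?_, fun x hx => hmy.trans_le (hm.2 (.inl ⟨x, hx, rfl⟩)),
      fun u hu => hy1 u (Finset.mem_insert_of_mem hu),
      fun l hl => hmy.trans_le (hm.2 (.inr hl))⟩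
    have h1 := (hright m hm.1).1 x hx
    by_contra! h
    refine h1.ne (hq x ((hy1 q₁ (Finset.mem_insert_self _ _)).trans_le h) (h1.trans hq₂))
  obtain ⟨hXne, hXmax, hXL⟩ := hcl
  obtain ⟨hYne, hYmin, hYU⟩ := hcu
  obtain ⟨γ, hγ, hγX⟩ := exists_irrational_cut hXlow hXne
    (hYne.mono fun x hx => (hXY x).2 hx) hXmax (fun x hx => by
      obtain ⟨x', hx', h⟩ := hYmin x ((hXY x).1 hx)
      exact ⟨x', (hXY x').2 hx', h⟩)
  have hγY : ∀ x : ℚ, x ∈ Y ↔ γ < x := fun x => by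
    rw [← hXY, hγX, not_lt]
    exact ⟨fun h => h.lt_of_ne fun h' => hγ ⟨x, h'.symm⟩, le_of_lt⟩
  have hmax : ∃ x₀ ∈ X, ∀ l ∈ L, l < k x₀ := by
    by_cases hLne : L.Nonempty
    · obtain ⟨x, hx, h⟩ := hXL _ (L.max'_mem hLne)
      exact ⟨x, hx, fun l hl => (L.le_max' l hl).trans_lt h⟩
    · obtain ⟨x, hx⟩ := hXne
      exact ⟨x, hx, fun l hl => (hLne ⟨l, hl⟩).elim⟩
  have hmin : ∃ x₀ ∈ Y, ∀ u ∈ U, k x₀ < u := by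
    by_cases hUne : U.Nonempty
    · obtain ⟨x, hx, h⟩ := hYU _ (U.min'_mem hUne)
      exact ⟨x, hx, fun l hl => h.trans_le (U.min'_le l hl)⟩
    · obtain ⟨x, hx⟩ := hYne
      exact ⟨x, hx, fun l hl => (hUne ⟨l, hl⟩).elim⟩
  obtain ⟨x₀, hx₀, hx₀L⟩ := hmax
  obtain ⟨x₁, hx₁, hx₁U⟩ := hmin
  -- `X` contains a point beyond all of `L`, which can only be there because `τ < f z`. Monotonicity
  -- extends this to all of `X`, so `f z` witnesses a gap of `τ`.
  have hXlt : ∀ x ∈ X, τ x < f z := by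
    have h₀ : τ x₀ < f z := hx₀.resolve_right fun ⟨l, hl, h⟩ => h.not_gt (hx₀L l hl)
    intro x hx
    rcases hx with h | ⟨l, hl, h⟩
    · exact h
    · exact (hτ (hk.lt_iff_lt.1 (h.trans_lt (hx₀L l hl))).le).trans_lt h₀
  have hYgt : ∀ x ∈ Y, f z < τ x := by
    have h₁ : f z < τ x₁ := hx₁.resolve_right fun ⟨l, hl, h⟩ => h.not_gt (hx₁U l hl)
    intro x hx
    rcases hx with h | ⟨l, hl, h⟩
    · exact h
    · exact h₁.trans_le (hτ (hk.lt_iff_lt.1 ((hx₁U l hl).trans_le h)).le)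
  obtain ⟨-, y, hy⟩ := hgap ⟨hγ, f z, fun x =>
    ⟨fun h => hXlt x ((hγX x).2 h), fun h => hYgt x ((hγY x).2 h)⟩⟩
  refine ⟨y, fun x hx => (hy x).1 ((hγX x).1 hx), fun x hx => (hy x).2 ((hγY x).1 hx),
    fun l hl => (hx₀L l hl).trans ((hy x₀).1 ((hγX x₀).1 hx₀)),
    fun u hu => ((hy x₁).2 ((hγY x₁).1 hx₁)).trans (hx₁U u hu)⟩

/-- The equation holds because admissibility of the pair `(k x, a (k x))` contains it as its third
clause. -/
theorem exists_automorphism_comp_eq (hf : Function.Surjective f)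
    (hfl : ∀ z, ∃ z' < z, f z' = f z) (hfu : ∀ z, ∃ z' > z, f z' = f z) (hfm : Monotone f)
    (hk : StrictMono k) (hki : HasIsolatedImage k) (hτ : Monotone τ)
    (hgap : gaps k = gaps τ)
    (hlow : (∃ y, ∀ x, y < k x) ↔ ∃ q, ∀ x, q < τ x)
    (hupp : (∃ y, ∀ x, k x < y) ↔ ∃ q, ∀ x, τ x < q)
    {p : Finset (ℚ × ℚ)} (hp : IsPartialIso (IsAdmissible f k τ) p) :
    ∃ a : ℚ ≃o ℚ, (∀ c ∈ p, a c.1 = c.2) ∧ ∀ x, f (a (k x)) = τ x := by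
  obtain ⟨E, hpE, hER, hE, hl, hr⟩ := exists_relation_of_back_and_forth
    (Set.countable_univ (α := ℚ)) (Set.countable_univ (α := ℚ)) hp
    (fun p hp y _ _ => exists_value_of_isPartialIso hf hfl hfu hfm hk hτ hgap.le hlow.1
      hupp.1 hp)
    (fun p hp z _ _ => exists_argument_of_isPartialIso hfm hk hki hτ hgap.ge hlow.2 hupp.2 hp)
  obtain ⟨a, ha⟩ := exists_orderIso_of_relation hE (fun y => hl y trivial) (fun z => hr z trivial)
  refine ⟨a, fun c hc => ?_, fun x => ((hER _ _ (ha (k x)) x).2.2 rfl).symm⟩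
  have h1 := hE _ _ _ _ (ha c.1) (hpE c hc)
  have h2 := hE _ _ _ _ (hpE c hc) (ha c.1)
  exact le_antisymm (not_lt.1 fun h => lt_irrefl _ (h2.2 h))
    (not_lt.1 fun h => lt_irrefl _ (h1.2 h))

end Automorphism

/-! ### Automorphisms with prescribed action on irrational cuts. -/

/-- Automorphisms of `ℚ` whose extension to `ℝ` maps a given countable dense set of irrational
numbers onto another one. -/
theorem exists_automorphism_map_irrationals {P Q : Set ℝ} (hPc : P.Countable) (hQc : Q.Countable)
    (hPi : ∀ ε ∈ P, Irrational ε) (hQi : ∀ δ ∈ Q, Irrational δ)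
    (hP : ∀ x y : ℝ, x < y → ∃ ε ∈ P, x < ε ∧ ε < y)
    (hQ : ∀ x y : ℝ, x < y → ∃ δ ∈ Q, x < δ ∧ δ < y)
    {p : Finset (ℝ × ℝ)}
    (hp : IsPartialIso (fun v w => (v ∈ Set.range ((↑) : ℚ → ℝ) ∧ w ∈ Set.range ((↑) : ℚ → ℝ)) ∨
      (v ∈ P ∧ w ∈ Q)) p) :
    ∃ b : ℚ ≃o ℚ, (∀ c ∈ p, ∀ q : ℚ, (q : ℝ) < c.1 ↔ (b q : ℝ) < c.2) ∧
      (∀ ε ∈ P, ∃ δ ∈ Q, ∀ q : ℚ, (q : ℝ) < ε ↔ (b q : ℝ) < δ) ∧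
      ∀ δ ∈ Q, ∃ ε ∈ P, ∀ q : ℚ, (q : ℝ) < ε ↔ (b q : ℝ) < δ := by
  classical
  have hbetw : ∀ L U : Finset ℝ, (∀ l ∈ L, ∀ u ∈ U, l < u) →
      ∃ x y : ℝ, x < y ∧ (∀ l ∈ L, l ≤ x) ∧ ∀ u ∈ U, y ≤ u := by
    intro L U h
    obtain ⟨x, hx1, hx2⟩ := Order.exists_between_finsets L U h
    obtain ⟨y, hy1, hy2⟩ := Order.exists_between_finsets {x} U (by simpa using hx2)
    exact ⟨x, y, hy1 x (by simp), fun l hl => (hx1 l hl).le, fun u hu => (hy2 u hu).le⟩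
  -- Back-and-forth runs on rationals and chosen irrationals at once. Pairs never mix the two kinds,
  -- so `E` restricts to an automorphism of `ℚ` and records how its extension moves `P`.
  obtain ⟨E, hpE, hER, hE, hl, hr⟩ := exists_relation_of_back_and_forth
    (A := Set.range ((↑) : ℚ → ℝ) ∪ P) (B := Set.range ((↑) : ℚ → ℝ) ∪ Q)
    ((Set.countable_range _).union hPc) ((Set.countable_range _).union hQc) hp
    (fun p hp v hv _ => by
      obtain ⟨x, y, hxy, hx, hy⟩ := hbetw ((p.filter fun c => c.1 < v).image Prod.snd)
        ((p.filter fun c => v < c.1).image Prod.snd) (by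
          simp only [Finset.mem_image, Finset.mem_filter]
          rintro _ ⟨c, ⟨hc, hcy⟩, rfl⟩ _ ⟨d, ⟨hd, hdy⟩, rfl⟩
          exact (hp.2 c hc d hd).1 (hcy.trans hdy))
      have key : ∀ w, x < w → w < y → ∀ c ∈ p, (c.1 < v → c.2 < w) ∧ (v < c.1 → w < c.2) :=
        fun w hw hw' c hc =>
          ⟨fun h => (hx _ (Finset.mem_image_of_mem _ (Finset.mem_filter.2 ⟨hc, h⟩))).trans_lt hw,
          fun h => hw'.trans_le (hy _ (Finset.mem_image_of_mem _ (Finset.mem_filter.2 ⟨hc, h⟩)))⟩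
      rcases hv with hv | hv
      · obtain ⟨w, hw, hw'⟩ := exists_rat_btwn hxy
        exact ⟨w, .inl ⟨hv, w, rfl⟩, key _ hw hw'⟩
      · obtain ⟨w, hwQ, hw, hw'⟩ := hQ _ _ hxy
        exact ⟨w, .inr ⟨hv, hwQ⟩, key _ hw hw'⟩)
    (fun p hp v hv _ => by
      obtain ⟨x, y, hxy, hx, hy⟩ := hbetw ((p.filter fun c => c.2 < v).image Prod.fst)
        ((p.filter fun c => v < c.2).image Prod.fst) (by
          simp only [Finset.mem_image, Finset.mem_filter]
          rintro _ ⟨c, ⟨hc, hcy⟩, rfl⟩ _ ⟨d, ⟨hd, hdy⟩, rfl⟩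
          exact (hp.2 c hc d hd).2 (hcy.trans hdy))
      have key : ∀ w, x < w → w < y → ∀ c ∈ p, (c.2 < v → c.1 < w) ∧ (v < c.2 → w < c.1) :=
        fun w hw hw' c hc =>
          ⟨fun h => (hx _ (Finset.mem_image_of_mem _ (Finset.mem_filter.2 ⟨hc, h⟩))).trans_lt hw,
          fun h => hw'.trans_le (hy _ (Finset.mem_image_of_mem _ (Finset.mem_filter.2 ⟨hc, h⟩)))⟩
      rcases hv with hv | hv
      · obtain ⟨w, hw, hw'⟩ := exists_rat_btwn hxy
        exact ⟨w, .inl ⟨⟨w, rfl⟩, hv⟩, key _ hw hw'⟩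
      · obtain ⟨w, hwQ, hw, hw'⟩ := hP _ _ hxy
        exact ⟨w, .inr ⟨hwQ, hv⟩, key _ hw hw'⟩)
  obtain ⟨b, hb⟩ := exists_orderIso_of_relation (E := fun v w : ℚ => E v w)
    (fun v w v' w' h h' => by simpa using hE _ _ _ _ h h')
    (fun v => by
      obtain ⟨w, hw⟩ := hl v (.inl ⟨v, rfl⟩)
      rcases hER _ _ hw with ⟨-, w', rfl⟩ | ⟨h, -⟩
      exacts [⟨w', hw⟩, (hPi _ h ⟨v, rfl⟩).elim])
    (fun w => by
      obtain ⟨v, hv⟩ := hr w (.inl ⟨w, rfl⟩)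
      rcases hER _ _ hv with ⟨⟨v', rfl⟩, -⟩ | ⟨-, h⟩
      exacts [⟨v', hv⟩, (hQi _ h ⟨w, rfl⟩).elim])
  refine ⟨b, fun c hc q => hE _ _ _ _ (hb q) (hpE c hc), fun ε hε => ?_, fun δ hδ => ?_⟩
  · obtain ⟨δ, hδ⟩ := hl ε (.inr hε)
    rcases hER _ _ hδ with ⟨⟨q, rfl⟩, -⟩ | ⟨-, h⟩
    exacts [(hPi _ hε ⟨q, rfl⟩).elim, ⟨δ, h, fun q => hE _ _ _ _ (hb q) hδ⟩]
  · obtain ⟨ε, hε⟩ := hr δ (.inr hδ)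
    rcases hER _ _ hε with ⟨-, q, rfl⟩ | ⟨h, -⟩
    exacts [(hQi _ hδ ⟨q, rfl⟩).elim, ⟨ε, h, fun q => hE _ _ _ _ (hb q) hε⟩]

/-! ### Sections of surjections whose fibres have no endpoints. -/

/-- `g` is a section of the increasing map `f`, whose fibres have neither a least nor a greatest
element. -/
structure IsOpenFiberSection (f g : ℚ → ℚ) : Prop where
  monotone : Monotone f
  apply_section : ∀ x, f (g x) = x
  exists_lt : ∀ z, ∃ z' < z, f z' = f z
  exists_gt : ∀ z, ∃ z' > z, f z' = f z

namespace IsOpenFiberSection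

variable {f g : ℚ → ℚ} (hfg : IsOpenFiberSection f g)
include hfg

theorem surjective : Function.Surjective f := fun x => ⟨g x, hfg.apply_section x⟩

theorem lt_of_lt_apply {x v : ℚ} (h : x < f v) : g x < v := by
  by_contra! h'
  exact h.not_ge ((hfg.monotone h').trans_eq (hfg.apply_section x))

theorem lt_of_apply_lt {x v : ℚ} (h : f v < x) : v < g x := by
  by_contra! h'
  exact h.not_ge ((hfg.apply_section x).ge.trans (hfg.monotone h'))

theorem le_apply {x v : ℚ} (h : g x ≤ v) : x ≤ f v :=
  not_lt.1 fun h' => h.not_gt (hfg.lt_of_apply_lt h')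

theorem apply_le {x v : ℚ} (h : v ≤ g x) : f v ≤ x :=
  not_lt.1 fun h' => h.not_gt (hfg.lt_of_lt_apply h')

theorem strictMono_section : StrictMono g := fun x y h =>
  hfg.lt_of_lt_apply (by rwa [hfg.apply_section])

/-- Around `q` there is an interval with endpoints in the fibre of `f q`, and the only value of `g`
it can contain is `g (f q)`. If this differs from `q`, the interval is shortened to exclude it. -/
theorem hasIsolatedImage : HasIsolatedImage g := by
  intro q
  obtain ⟨z₁, hz₁, e₁⟩ := hfg.exists_lt q
  obtain ⟨z₂, hz₂, e₂⟩ := hfg.exists_gt q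
  have key : ∀ x, z₁ < g x → g x < z₂ → g x = g (f q) := fun x h1 h2 => by
    rw [le_antisymm ((hfg.le_apply h2.le).trans_eq e₂) (e₁.ge.trans (hfg.apply_le h1.le))]
  rcases lt_trichotomy (g (f q)) q with h | h | h
  · exact ⟨max z₁ (g (f q)), z₂, max_lt hz₁ h, hz₂, fun x h1 h2 =>
      (((le_max_right _ _).trans_lt h1).ne' (key x ((le_max_left _ _).trans_lt h1) h2)).elim⟩
  · exact ⟨z₁, z₂, hz₁, hz₂, fun x h1 h2 => (key x h1 h2).trans h⟩
  · exact ⟨z₁, min z₂ (g (f q)), hz₁, lt_min hz₂ h, fun x h1 h2 =>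
      ((h2.trans_le (min_le_right _ _)).ne (key x h1 (h2.trans_le (min_le_left _ _)))).elim⟩

/-- The rational `f v` lies on one side of `γ`, and `g` at a rational between them is on the wrong
side of `v`. In particular `g` has no gaps. -/
theorem not_separates {γ : ℝ} (hγ : Irrational γ) {v : ℚ} (h1 : ∀ x : ℚ, (x : ℝ) < γ → g x ≤ v)
    (h2 : ∀ x : ℚ, γ < x → v ≤ g x) : False := by
  rcases hγ.lt_or_gt_rat (f v) with h | h
  · obtain ⟨x, hx, hx'⟩ := exists_rat_btwn h
    exact (h1 x hx').not_gt (hfg.lt_of_apply_lt (by exact_mod_cast hx))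
  · obtain ⟨x, hx, hx'⟩ := exists_rat_btwn h
    exact (h2 x hx).not_gt (hfg.lt_of_lt_apply (by exact_mod_cast hx'))

/-- The real extension of `g` at irrational numbers. -/
theorem exists_extension {γ : ℝ} (hγ : Irrational γ) :
    ∃ ε : ℝ, Irrational ε ∧ ∀ x : ℚ, (g x : ℝ) < ε ↔ (x : ℝ) < γ := by
  set S : Set ℝ := (fun x : ℚ => (g x : ℝ)) '' {x : ℚ | (x : ℝ) < γ} with hS
  have hub : ∀ x : ℚ, γ < x → (g x : ℝ) ∈ upperBounds S := by
    rintro x hx _ ⟨x', hx', rfl⟩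
    exact Rat.cast_le.2 (hfg.strictMono_section (Rat.cast_lt.1 (lt_trans hx' hx))).le
  obtain ⟨u, hu⟩ := exists_rat_gt γ
  obtain ⟨l, hl⟩ := exists_rat_lt γ
  have hbdd : BddAbove S := ⟨_, hub u hu⟩
  have h1 : ∀ x : ℚ, (x : ℝ) < γ → (g x : ℝ) < sSup S := by
    intro x hx
    obtain ⟨x', hx1, hx2⟩ := exists_rat_btwn hx
    exact lt_of_lt_of_le (Rat.cast_lt.2 (hfg.strictMono_section (Rat.cast_lt.1 hx1)))
      (le_csSup hbdd ⟨x', hx2, rfl⟩)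
  have h2 : ∀ x : ℚ, γ < x → sSup S ≤ g x := fun x hx => csSup_le ⟨_, l, hl, rfl⟩ (hub x hx)
  refine ⟨sSup S, ?_, fun x => ⟨fun h => ?_, h1 x⟩⟩
  · rintro ⟨v, hv⟩
    refine hfg.not_separates hγ (v := v) (fun x hx => ?_) fun x hx => ?_
    · have := h1 x hx
      rw [← hv] at this
      exact (Rat.cast_lt.1 this).le
    · have := h2 x hx
      rw [← hv] at this
      exact Rat.cast_le.1 this
  · exact (hγ.lt_or_gt_rat x).resolve_right fun h' => (h2 x h').not_gt h

end IsOpenFiberSection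

/-! ### Choosing `b` so that `h ∘ b ∘ g` has the gaps of `τ`. -/

/-- Irrational numbers which an automorphism `b` with `f ∘ a ∘ h ∘ b ∘ g = τ` may map to a gap
of `h`. -/
def IsCompatible (g τ : ℚ → ℚ) (ε : ℝ) : Prop :=
  Irrational ε ∧ ((∃ v v' : ℚ, (v : ℝ) < ε ∧ ε < v' ∧ ∀ x, g x < v ∨ v' < g x) ∨
    ∃ γ ∈ gaps τ, ∀ x : ℚ, (g x : ℝ) < ε ↔ (x : ℝ) < γ)

/-- Isolation leaves a hole of the image of `g` just above `q`, in which any irrational is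
compatible. This makes compatible numbers dense and realises the cut `g x ≤ q`. -/
theorem exists_isCompatible_between {g : ℚ → ℚ} (hg : HasIsolatedImage g) (τ : ℚ → ℚ) {q : ℚ}
    {y : ℝ} (hq : q < y) :
    ∃ ε : ℝ, IsCompatible g τ ε ∧ q < ε ∧ ε < y ∧ ∀ x, (g x : ℝ) < ε ↔ g x ≤ q := by
  obtain ⟨q₁, q₂, hq₁, hq₂, h⟩ := hg q
  obtain ⟨u, hu1, hu2⟩ := exists_rat_btwn (show (q : ℝ) < min y q₂ from
    lt_min hq (by exact_mod_cast hq₂))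
  have huq : q < u := by exact_mod_cast hu1
  obtain ⟨v, hv1, hv2⟩ := exists_between huq
  obtain ⟨ε, hε, h1, h2⟩ := exists_irrational_btwn (show (v : ℝ) < u by exact_mod_cast hv2)
  have huq₂ : u < q₂ := by exact_mod_cast hu2.trans_le (min_le_right _ _)
  have key : ∀ x, g x ≤ q ∨ u < g x := by
    intro x
    by_contra! hx
    exact hx.1.ne' (h x (hq₁.trans hx.1) (hx.2.trans_lt huq₂))
  have hqv : (q : ℝ) < v := by exact_mod_cast hv1
  refine ⟨ε, ⟨hε, .inl ⟨v, u, h1, h2, fun x => (key x).imp_left fun h => h.trans_lt hv1⟩⟩,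
    hqv.trans h1, h2.trans (hu2.trans_le (min_le_left _ _)), fun x => ⟨fun hx => ?_, fun hx => ?_⟩⟩
  · refine (key x).resolve_right fun hx' => ?_
    have : (u : ℝ) < g x := by exact_mod_cast hx'
    linarith
  · have : (g x : ℝ) ≤ q := by exact_mod_cast hx
    linarith

theorem exists_isCompatible_lt {g : ℚ → ℚ} (hg : HasIsolatedImage g) (τ : ℚ → ℚ) (q : ℚ) :
    ∃ ε : ℝ, IsCompatible g τ ε ∧ ∀ x, (g x : ℝ) < ε ↔ g x < q := by
  obtain ⟨q₁, q₂, hq₁, hq₂, h⟩ := hg q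
  obtain ⟨u, hu1, hu2⟩ := exists_between hq₁
  obtain ⟨v, hv1, hv2⟩ := exists_between hu2
  obtain ⟨ε, hε, h1, h2⟩ := exists_irrational_btwn (show (u : ℝ) < v by exact_mod_cast hv1)
  have key : ∀ x, g x < u ∨ q ≤ g x := by
    intro x
    by_contra! hx
    exact hx.2.ne (h x (hu1.trans_le hx.1) (hx.2.trans hq₂))
  have hqv : (v : ℝ) < q := by exact_mod_cast hv2
  refine ⟨ε, ⟨hε, .inl ⟨u, v, h1, h2, fun x => (key x).imp_right fun h => hv2.trans_le h⟩⟩,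
    fun x => ⟨fun hx => ?_, fun hx => ?_⟩⟩
  · have : (g x : ℝ) < q := hx.trans (h2.trans hqv)
    exact_mod_cast this
  · have : (g x : ℝ) < u := by exact_mod_cast (key x).resolve_right hx.not_ge
    linarith

/-- Every position of `y` relative to the image of `h` is described by at most one rational
argument, except when `y` lies in a gap of `h`. -/
theorem exists_cut {h : ℚ → ℚ} (hh : StrictMono h) (y : ℚ) :
    (∃ w, h w = y) ∨ (∃ w, ∀ w', (h w' < y ↔ w' ≤ w) ∧ (y < h w' ↔ ¬ w' ≤ w)) ∨
      (∃ w, ∀ w', (h w' < y ↔ w' < w) ∧ (y < h w' ↔ ¬ w' < w)) ∨ (∀ w, y < h w) ∨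
      (∀ w, h w < y) ∨ ∃ δ ∈ gaps h, ∀ w : ℚ, (h w < y ↔ (w : ℝ) < δ) ∧ (y < h w ↔ δ < w) := by
  by_cases hy : ∃ w, h w = y
  · exact .inl hy
  have hne : ∀ w, y < h w ↔ ¬ h w < y := fun w =>
    ⟨fun h' => h'.not_gt, fun h' => (lt_or_gt_of_ne fun e => hy ⟨w, e⟩).resolve_left h'⟩
  by_cases hlow : ∀ w, y < h w
  · exact .inr (.inr (.inr (.inl hlow)))
  by_cases hupp : ∀ w, h w < y
  · exact .inr (.inr (.inr (.inr (.inl hupp))))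
  have hX : IsLowerSet {w | h w < y} := fun a b hba ha => (hh.monotone hba).trans_lt ha
  by_cases hmax : ∀ x ∈ {w | h w < y}, ∃ x' ∈ {w | h w < y}, x < x'
  · by_cases hmin : ∀ x ∉ {w | h w < y}, ∃ x' ∉ {w | h w < y}, x' < x
    · push Not at hlow hupp
      obtain ⟨l, hl⟩ := hlow
      obtain ⟨u, hu⟩ := hupp
      obtain ⟨δ, hδ, hδX⟩ := exists_irrational_cut hX
        ⟨l, by simpa using hl.lt_of_ne fun e => hy ⟨l, e⟩⟩ ⟨u, by simpa using hu⟩ hmax hmin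
      have hδX' : ∀ w : ℚ, y < h w ↔ δ < w := fun w => by
        rw [hne, show h w < y ↔ (w : ℝ) < δ from hδX w, not_lt]
        exact ⟨fun h => h.lt_of_ne fun h' => hδ ⟨w, h'.symm⟩, le_of_lt⟩
      exact .inr (.inr (.inr (.inr (.inr ⟨δ, ⟨hδ, y, fun w => ⟨(hδX w).2, (hδX' w).2⟩⟩,
        fun w => ⟨hδX w, hδX' w⟩⟩))))
    · push Not at hmin
      obtain ⟨w, hw, hmin⟩ := hmin
      have : ∀ w', h w' < y ↔ w' < w := fun w' =>
        ⟨fun h' => hh.lt_iff_lt.1 (lt_of_lt_of_le h' (not_lt.1 hw)), fun h' => by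
          by_contra h''
          exact (hmin w' h'').not_gt h'⟩
      exact .inr (.inr (.inl ⟨w, fun w' => ⟨this w', by rw [hne, this]⟩⟩))
  · push Not at hmax
    obtain ⟨w, hw, hmax⟩ := hmax
    have : ∀ w', h w' < y ↔ w' ≤ w := fun w' =>
      ⟨fun h' => hmax w' h', fun h' => hX h' hw⟩
    exact .inr (.inl ⟨w, fun w' => ⟨this w', by rw [hne, this]⟩⟩)

section Middle

variable {f g h τ : ℚ → ℚ}

/-- Let `y` witness a gap of the composite. Any position of `y` other than in a gap `δ` of `h`
contradicts `not_separates` or the existence of rationals on both sides of the cut. If `δ` comes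
from a hole of the image of `g`, an endpoint of the hole would separate `g`, again impossible; so
`δ` comes from a gap of `τ`, necessarily the same one. -/
theorem gaps_comp_eq (hfg : IsOpenFiberSection f g) (hh : StrictMono h) {b : ℚ ≃o ℚ}
    (h1 : ∀ γ ∈ gaps τ, ∃ ε : ℝ, (∀ x : ℚ, (g x : ℝ) < ε ↔ (x : ℝ) < γ) ∧
      ∃ δ ∈ gaps h, ∀ q : ℚ, (q : ℝ) < ε ↔ (b q : ℝ) < δ)
    (h2 : ∀ δ ∈ gaps h, ∃ ε, IsCompatible g τ ε ∧ ∀ q : ℚ, (q : ℝ) < ε ↔ (b q : ℝ) < δ) :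
    gaps (fun x => h (b (g x))) = gaps τ := by
  ext γ
  constructor
  · rintro ⟨hγ, y, hy⟩
    have hsep : ∀ v, (∀ x : ℚ, (x : ℝ) < γ → b (g x) ≤ b v) →
        ¬ ∀ x : ℚ, γ < x → b v ≤ b (g x) := fun v h1 h2 =>
      hfg.not_separates hγ (fun x hx => b.le_iff_le.1 (h1 x hx)) fun x hx =>
        b.le_iff_le.1 (h2 x hx)
    have hsep' : ∀ w, (∀ x : ℚ, (x : ℝ) < γ → b (g x) ≤ w) →
        ¬ ∀ x : ℚ, γ < x → w ≤ b (g x) := fun w => by simpa using hsep (b.symm w)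
    rcases exists_cut hh y with ⟨w, rfl⟩ | ⟨w, hw⟩ | ⟨w, hw⟩ | hw | hw | ⟨δ, hδ, hw⟩
    · exact (hsep' w (fun x hx => (hh.lt_iff_lt.1 ((hy x).1 hx)).le)
        fun x hx => (hh.lt_iff_lt.1 ((hy x).2 hx)).le).elim
    · exact (hsep' w (fun x hx => (hw _).1.1 ((hy x).1 hx))
        fun x hx => (not_le.1 ((hw _).2.1 ((hy x).2 hx))).le).elim
    · exact (hsep' w (fun x hx => ((hw _).1.1 ((hy x).1 hx)).le)
        fun x hx => not_lt.1 ((hw _).2.1 ((hy x).2 hx))).elim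
    · obtain ⟨x, hx⟩ := exists_rat_lt γ
      exact ((hw _).not_gt ((hy x).1 hx)).elim
    · obtain ⟨x, hx⟩ := exists_rat_gt γ
      exact ((hw _).not_gt ((hy x).2 hx)).elim
    · obtain ⟨ε, ⟨hε, hcomp⟩, hεδ⟩ := h2 δ hδ
      have hl : ∀ x : ℚ, (x : ℝ) < γ → (g x : ℝ) < ε := fun x hx =>
        (hεδ _).2 ((hw _).1.1 ((hy x).1 hx))
      have hr : ∀ x : ℚ, γ < x → ¬ (g x : ℝ) < ε := fun x hx h =>
        ((hw _).2.1 ((hy x).2 hx)).not_gt ((hεδ _).1 h)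
      rcases hcomp with ⟨v, v', hv, hv', hout⟩ | ⟨γ', hγ', hγε⟩
      · refine (hfg.not_separates hγ (v := v) (fun x hx => ?_) fun x hx => ?_).elim
        · refine ((hout x).resolve_right fun h' => ?_).le
          exact (hl x hx).not_gt (hv'.trans (Rat.cast_lt.2 h'))
        · rcases hout x with h' | h'
          · exact (hr x hx ((Rat.cast_lt.2 h').trans hv)).elim
          · exact (Rat.cast_lt.1 ((hv.trans hv').trans (Rat.cast_lt.2 h'))).le
      · suffices γ = γ' by rwa [this]
        rcases lt_trichotomy γ γ' with hlt | heq | hlt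
        · obtain ⟨x, hx, hx'⟩ := exists_rat_btwn hlt
          exact (hr x hx ((hγε x).2 hx')).elim
        · exact heq
        · obtain ⟨x, hx, hx'⟩ := exists_rat_btwn hlt
          exact (hx.not_gt ((hγε x).1 (hl x hx'))).elim
  · intro hγ
    obtain ⟨ε, hε, δ, ⟨hδ, y, hy⟩, hεδ⟩ := h1 γ hγ
    refine ⟨hγ.1, y, fun x => ⟨fun hx => (hy _).1 ((hεδ _).1 ((hε x).2 hx)), fun hx => ?_⟩⟩
    refine (hy _).2 ((hδ.lt_or_gt_rat _).resolve_left fun h => ?_)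
    exact hx.not_gt ((hε x).1 ((hεδ _).2 h))

theorem exists_automorphism_gaps_eq (hfg : IsOpenFiberSection f g) (hh : StrictMono h)
    (hdense : ∀ x y : ℝ, x < y → ∃ δ ∈ gaps h, x < δ ∧ δ < y) {p : Finset (ℝ × ℝ)}
    (hp : IsPartialIso (fun v w => (v ∈ Set.range ((↑) : ℚ → ℝ) ∧ w ∈ Set.range ((↑) : ℚ → ℝ)) ∨
      (IsCompatible g τ v ∧ w ∈ gaps h)) p) :
    ∃ b : ℚ ≃o ℚ, (∀ c ∈ p, ∀ q : ℚ, (q : ℝ) < c.1 ↔ (b q : ℝ) < c.2) ∧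
      (∀ δ ∈ gaps h, ∃ ε, IsCompatible g τ ε ∧ ∀ q : ℚ, (q : ℝ) < ε ↔ (b q : ℝ) < δ) ∧
      gaps (fun x => h (b (g x))) = gaps τ := by
  classical
  choose! e he heg using fun γ (hγ : γ ∈ gaps τ) => hfg.exists_extension hγ.1
  choose! o ho using fun (c : ℚ × ℚ) (hc : c.1 < c.2) =>
    exists_isCompatible_between hfg.hasIsolatedImage τ (q := c.1) (y := c.2) (by exact_mod_cast hc)
  -- There are uncountably many compatible numbers, so a countable set of them is used: those
  -- prescribed by `p`, the images of all gaps of `τ` (each must be realised), and numbers in holes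
  -- for density.
  set P : Set ℝ := {ε | IsCompatible g τ ε ∧ ε ∈ p.image Prod.fst} ∪ e '' gaps τ ∪
    o '' {c : ℚ × ℚ | c.1 < c.2} with hP
  have hcomp : ∀ ε ∈ P, IsCompatible g τ ε := by
    rintro ε ((h | ⟨γ, hγ, rfl⟩) | ⟨c, hc, rfl⟩)
    · exact h.1
    · exact ⟨he γ hγ, .inr ⟨γ, hγ, heg γ hγ⟩⟩
    · exact (ho c hc).1
  obtain ⟨b, hbp, hbP, hbQ⟩ := exists_automorphism_map_irrationals (P := P) (Q := gaps h) (p := p)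
    ((((p.image Prod.fst).countable_toSet.mono fun ε h => h.2).union
      ((gaps_countable τ).image _)).union ((Set.to_countable _).image _)) (gaps_countable h)
    (fun ε hε => (hcomp ε hε).1) (fun δ hδ => hδ.1)
    (fun x y hxy => by
      obtain ⟨q, hq, hq'⟩ := exists_rat_btwn hxy
      obtain ⟨q', hq1, hq2⟩ := exists_rat_btwn hq'
      have hqq : q < q' := by exact_mod_cast hq1
      obtain ⟨-, h1, h2, -⟩ := ho (q, q') hqq
      exact ⟨o (q, q'), .inr ⟨_, hqq, rfl⟩, hq.trans h1, h2.trans hq2⟩)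
    hdense
    ⟨fun c hc => (hp.1 c hc).imp_right fun h =>
      ⟨.inl (.inl ⟨h.1, Finset.mem_image_of_mem _ hc⟩), h.2⟩, hp.2⟩
  have hbQ' : ∀ δ ∈ gaps h, ∃ ε, IsCompatible g τ ε ∧ ∀ q : ℚ, (q : ℝ) < ε ↔ (b q : ℝ) < δ :=
    fun δ hδ => by
      obtain ⟨ε, hε, h⟩ := hbQ δ hδ
      exact ⟨ε, hcomp ε hε, h⟩
  refine ⟨b, hbp, hbQ', gaps_comp_eq hfg hh (fun γ hγ => ?_) hbQ'⟩
  exact ⟨e γ, heg γ hγ, hbP _ (.inl (.inr ⟨γ, hγ, rfl⟩))⟩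

theorem exists_lt_comp_iff (hfg : IsOpenFiberSection f g) (hh : Monotone h) (b : ℚ ≃o ℚ) :
    (∃ y, ∀ x, y < h (b (g x))) ↔ ∃ y, ∀ w, y < h w := by
  refine ⟨fun ⟨y, hy⟩ => ⟨y, fun w => (hy (f (b.symm w) - 1)).trans_le (hh ?_)⟩,
    fun ⟨y, hy⟩ => ⟨y, fun x => hy _⟩⟩
  rw [← b.le_symm_apply]
  exact (hfg.lt_of_lt_apply (sub_one_lt _)).le

theorem exists_comp_lt_iff (hfg : IsOpenFiberSection f g) (hh : Monotone h) (b : ℚ ≃o ℚ) :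
    (∃ y, ∀ x, h (b (g x)) < y) ↔ ∃ y, ∀ w, h w < y := by
  refine ⟨fun ⟨y, hy⟩ => ⟨y, fun w => (hh ?_).trans_lt (hy (f (b.symm w) + 1))⟩,
    fun ⟨y, hy⟩ => ⟨y, fun x => hy _⟩⟩
  rw [← b.symm_apply_le]
  exact (hfg.lt_of_apply_lt (lt_add_one _)).le

theorem exists_automorphism_of_gaps_eq (hfg : IsOpenFiberSection f g) (hh : StrictMono h)
    (hhi : HasIsolatedImage h) (hτ : Monotone τ) {b : ℚ ≃o ℚ}
    (hb : gaps (fun x => h (b (g x))) = gaps τ)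
    (hlow : (∃ y, ∀ x, y < h x) ↔ ∃ q, ∀ x, q < τ x)
    (hupp : (∃ y, ∀ x, h x < y) ↔ ∃ q, ∀ x, τ x < q)
    {p : Finset (ℚ × ℚ)}
    (hp : IsPartialIso (IsAdmissible f (fun x => h (b (g x))) τ) p) :
    ∃ a : ℚ ≃o ℚ, (∀ c ∈ p, a c.1 = c.2) ∧ ∀ x, f (a (h (b (g x)))) = τ x := by
  refine exists_automorphism_comp_eq hfg.surjective hfg.exists_lt hfg.exists_gt hfg.monotone
    (fun x y hxy => hh (b.strictMono (hfg.strictMono_section hxy))) (fun q => ?_) hτ hb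
    ((exists_lt_comp_iff hfg hh.monotone b).trans hlow)
    ((exists_comp_lt_iff hfg hh.monotone b).trans hupp) hp
  obtain ⟨q₁, q₂, h1, h2, h3⟩ := hhi q
  exact ⟨q₁, q₂, h1, h2, fun x => h3 _⟩

/-- Initial segments of `ℚ` which are not irrational cuts. -/
def IsRationalCut (X : Set ℚ) : Prop :=
  X = ∅ ∨ X = Set.univ ∨ ∃ p, X = Set.Iio p ∨ X = Set.Iic p

theorem IsOpenFiberSection.setOf_lt (hfg : IsOpenFiberSection f g) (v : ℚ) :
    {x | g x < v} = Set.Iio (f v) ∨ {x | g x < v} = Set.Iic (f v) := by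
  by_cases h : g (f v) < v
  · right
    ext x
    refine ⟨fun hx => hfg.le_apply (le_of_lt hx), fun hx => ?_⟩
    exact (hfg.strictMono_section.monotone hx).trans_lt h
  · left
    ext x
    refine ⟨fun hx => (hfg.le_apply (le_of_lt hx)).lt_of_ne ?_, fun hx => hfg.lt_of_lt_apply hx⟩
    rintro rfl
    exact h hx

theorem IsOpenFiberSection.setOf_le (hfg : IsOpenFiberSection f g) (v : ℚ) :
    {x | g x ≤ v} = Set.Iio (f v) ∨ {x | g x ≤ v} = Set.Iic (f v) := by
  by_cases h : g (f v) ≤ v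
  · right
    ext x
    refine ⟨fun hx => hfg.le_apply hx, fun hx => ?_⟩
    exact (hfg.strictMono_section.monotone hx).trans h
  · left
    ext x
    refine ⟨fun hx => (hfg.le_apply hx).lt_of_ne ?_, fun hx => (hfg.lt_of_lt_apply hx).le⟩
    rintro rfl
    exact h hx

/-- This decides whether the cut of `y` survives a change of `b`. Outside the gaps of `h`, one value
of `b` or none determines it. In a gap coming from a hole `(v, v')`, the values at `v` and `v'` do,
since `g` jumps over the hole. Only gaps of `τ` remain. -/
theorem exists_isRationalCut_or_gap (hfg : IsOpenFiberSection f g) (hh : StrictMono h)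
    {b : ℚ ≃o ℚ}
    (hb : ∀ δ ∈ gaps h, ∃ ε, IsCompatible g τ ε ∧ ∀ q : ℚ, (q : ℝ) < ε ↔ (b q : ℝ) < δ) (y : ℚ) :
    (∃ F : Finset ℚ, ∃ G₁ G₂ : Set ℚ, IsRationalCut G₁ ∧ IsRationalCut G₂ ∧
      ∀ b' : ℚ ≃o ℚ, (∀ v ∈ F, b' v = b v) →
        ∀ x, (h (b' (g x)) < y ↔ x ∈ G₁) ∧ (y < h (b' (g x)) ↔ x ∉ G₂)) ∨
    ∃ δ ∈ gaps h, (∀ w : ℚ, (h w < y ↔ (w : ℝ) < δ) ∧ (y < h w ↔ δ < w)) ∧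
      ∃ γ ∈ gaps τ, ∀ x : ℚ, (b (g x) : ℝ) < δ ↔ (x : ℝ) < γ := by
  have hlt : ∀ v, IsRationalCut {x | g x < v} := fun v => .inr (.inr ⟨_, hfg.setOf_lt v⟩)
  have hle : ∀ v, IsRationalCut {x | g x ≤ v} := fun v => .inr (.inr ⟨_, hfg.setOf_le v⟩)
  rcases exists_cut hh y with ⟨w, rfl⟩ | ⟨w, hw⟩ | ⟨w, hw⟩ | hw | hw | ⟨δ, hδ, hw⟩
  · left
    obtain ⟨v, rfl⟩ := b.surjective w
    refine ⟨{v}, _, _, hlt v, hle v, fun b' hb' x => ?_⟩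
    rw [← hb' v (Finset.mem_singleton_self _)]
    simp [hh.lt_iff_lt]
  · left
    obtain ⟨v, rfl⟩ := b.surjective w
    refine ⟨{v}, _, _, hle v, hle v, fun b' hb' x => ?_⟩
    rw [(hw _).1, (hw _).2, ← hb' v (Finset.mem_singleton_self _)]
    simp
  · left
    obtain ⟨v, rfl⟩ := b.surjective w
    refine ⟨{v}, _, _, hlt v, hlt v, fun b' hb' x => ?_⟩
    rw [(hw _).1, (hw _).2, ← hb' v (Finset.mem_singleton_self _)]
    simp
  · exact .inl ⟨∅, ∅, ∅, .inl rfl, .inl rfl, fun b' _ x => by simp [hw, (hw _).le]⟩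
  · exact .inl ⟨∅, Set.univ, Set.univ, .inr (.inl rfl), .inr (.inl rfl),
      fun b' _ x => by simp [hw, (hw _).le]⟩
  obtain ⟨ε, ⟨hε, ⟨v, v', hv, hv', hout⟩ | ⟨γ, hγ, hγε⟩⟩, hεδ⟩ := hb δ hδ
  · left
    refine ⟨{v, v'}, _, _, hlt v, hlt v, fun b' hb' x => ?_⟩
    have h1 : (b' v : ℝ) < δ := by
      rw [hb' v (by simp)]
      exact (hεδ v).1 hv
    have h2 : δ < b' v' := by
      rw [hb' v' (by simp)]
      exact (hδ.1.lt_or_gt_rat _).resolve_left fun h => hv'.not_gt ((hεδ v').2 h)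
    have hvv : v < v' := by exact_mod_cast hv.trans hv'
    rw [(hw _).1, (hw _).2]
    rcases hout x with hx | hx
    · have : (b' (g x) : ℝ) < δ := lt_trans (Rat.cast_lt.2 (b'.strictMono hx)) h1
      simp [hx, this, this.le]
    · have : δ < b' (g x) := lt_trans h2 (Rat.cast_lt.2 (b'.strictMono hx))
      simp [(hvv.trans hx).le, this, this.not_gt]
  · exact .inr ⟨δ, hδ, hw, γ, hγ, fun x => (hεδ _).symm.trans (hγε x)⟩

end Middle

/-! ### Open sets of the rich topology. -/

section RichTopology

theorem isOpen_pointSet (x y : ℚ) : IsOpen[richTopology] (pointSet x y) :=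
  .basic _ (.inl (.inl (.inl (.inl ⟨x, y, rfl⟩))))

theorem isOpen_imageSet_Iio (p q : ℚ) :
    IsOpen[richTopology] (imageSet (Set.Iio p) (Set.Iic q)) ∧
      IsOpen[richTopology] (imageSet (Set.Iio p) (Set.Iio q)) :=
  ⟨.basic _ (.inl (.inl (.inl (.inr ⟨p, q, .inl rfl⟩)))),
    .basic _ (.inl (.inl (.inl (.inr ⟨p, q, .inr rfl⟩))))⟩

theorem isOpen_imageSet_Ioi (p q : ℚ) :
    IsOpen[richTopology] (imageSet (Set.Ioi p) (Set.Ici q)) ∧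
      IsOpen[richTopology] (imageSet (Set.Ioi p) (Set.Ioi q)) :=
  ⟨.basic _ (.inl (.inl (.inr ⟨p, q, .inl rfl⟩))), .basic _ (.inl (.inl (.inr ⟨p, q, .inr rfl⟩)))⟩

theorem isOpen_boundednessSet {L U : Set EReal} (h : IsBoundednessType L U) :
    IsOpen[richTopology] (boundednessSet L U) :=
  .basic _ (.inl (.inr ⟨L, U, h, rfl⟩))

theorem isOpen_avoidSet {K : Set ℚ} (h : IsRationalInterval K) :
    IsOpen[richTopology] (avoidSet K) :=
  .basic _ (.inr ⟨K, h, rfl⟩)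

theorem isOpen_apply_mem (x : ℚ) (J : Set ℚ) : IsOpen[richTopology] {t : MQ | t x ∈ J} := by
  let _ : TopologicalSpace MQ := richTopology
  have : {t : MQ | t x ∈ J} = ⋃ y ∈ J, pointSet x y := by
    ext t
    simp [pointSet]
  rw [this]
  exact isOpen_biUnion fun y _ => isOpen_pointSet x y

theorem ratExt_le {x y : ℚ} : ratExt x ≤ ratExt y ↔ x ≤ y := by simp [ratExt]

theorem ratExt_lt {x y : ℚ} : ratExt x < ratExt y ↔ x < y := by simp [ratExt]

theorem isRationalInterval_rays (c : ℚ) :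
    IsRationalInterval (Set.Iio c) ∧ IsRationalInterval (Set.Iic c) ∧
      IsRationalInterval (Set.Ioi c) ∧ IsRationalInterval (Set.Ici c) := by
  refine ⟨⟨⊥, ratExt c, bot_le, .inr (.inl ?_)⟩, ⟨⊥, ratExt c, bot_le, .inl ?_⟩,
    ⟨ratExt c, ⊤, le_top, .inr (.inr (.inl ?_))⟩, ⟨ratExt c, ⊤, le_top, .inl ?_⟩⟩ <;>
  · ext x
    simp [ratExt_le, ratExt_lt]

theorem isRationalInterval_inter {A B : Set ℚ} {c d : ℚ} (hcd : c ≤ d)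
    (hA : A = Set.Ioi c ∨ A = Set.Ici c) (hB : B = Set.Iio d ∨ B = Set.Iic d) :
    IsRationalInterval (A ∩ B) := by
  refine ⟨ratExt c, ratExt d, ratExt_le.2 hcd, ?_⟩
  rcases hA with rfl | rfl <;> rcases hB with rfl | rfl
  · refine .inr (.inr (.inr ?_))
    ext x; simp [ratExt_lt]
  · refine .inr (.inr (.inl ?_))
    ext x; simp [ratExt_lt, ratExt_le]
  · refine .inr (.inl ?_)
    ext x; simp [ratExt_lt, ratExt_le]
  · refine .inl ?_
    ext x; simp [ratExt_le]

theorem avoidSet_eq (K : Set ℚ) : avoidSet K = {t : MQ | ∀ x, t x ∉ K} := by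
  ext t
  simp [avoidSet, Set.eq_empty_iff_forall_notMem]

/-- Each kind of rational cut calls on its own subbasic sets: the whole line on avoiding the
complementary ray, an open ray on the image conditions, a closed ray on these together with the
value at its endpoint. -/
theorem isOpen_forall_mem {G J : Set ℚ} (hG : IsRationalCut G) {c : ℚ}
    (hJ : J = Set.Iio c ∨ J = Set.Iic c) :
    IsOpen[richTopology] {t : MQ | ∀ x ∈ G, t x ∈ J} := by
  let _ : TopologicalSpace MQ := richTopology
  have himg : ∀ p, IsOpen[richTopology] (imageSet (Set.Iio p) J) := by
    rcases hJ with rfl | rfl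
    exacts [fun p => (isOpen_imageSet_Iio p c).2, fun p => (isOpen_imageSet_Iio p c).1]
  rcases hG with rfl | rfl | ⟨p, rfl | rfl⟩
  · simp
  · have h : IsRationalInterval Jᶜ := by
      rcases hJ with rfl | rfl
      · rw [Set.compl_Iio]; exact (isRationalInterval_rays c).2.2.2
      · rw [Set.compl_Iic]; exact (isRationalInterval_rays c).2.2.1
    simpa [avoidSet_eq] using isOpen_avoidSet h
  · simpa [imageSet, Set.subset_def] using himg p
  · convert (himg p).inter (isOpen_apply_mem p J) using 1
    ext t
    refine ⟨fun h => ⟨Set.image_subset_iff.2 fun x hx => h x (Set.mem_Iic.2 (le_of_lt hx)),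
      h p (Set.mem_Iic.2 le_rfl)⟩, fun h x hx => ?_⟩
    rcases (Set.mem_Iic.1 hx).lt_or_eq with h' | rfl
    exacts [Set.image_subset_iff.1 h.1 (Set.mem_Iio.2 h'), h.2]

theorem isOpen_forall_notMem {G J : Set ℚ} (hG : IsRationalCut G) {c : ℚ}
    (hJ : J = Set.Ioi c ∨ J = Set.Ici c) :
    IsOpen[richTopology] {t : MQ | ∀ x ∉ G, t x ∈ J} := by
  let _ : TopologicalSpace MQ := richTopology
  have himg : ∀ p, IsOpen[richTopology] (imageSet (Set.Ioi p) J) := by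
    rcases hJ with rfl | rfl
    exacts [fun p => (isOpen_imageSet_Ioi p c).2, fun p => (isOpen_imageSet_Ioi p c).1]
  rcases hG with rfl | rfl | ⟨p, rfl | rfl⟩
  · have h : IsRationalInterval Jᶜ := by
      rcases hJ with rfl | rfl
      · rw [Set.compl_Ioi]; exact (isRationalInterval_rays c).2.1
      · rw [Set.compl_Ici]; exact (isRationalInterval_rays c).1
    simpa [avoidSet_eq] using isOpen_avoidSet h
  · simp
  · convert (himg p).inter (isOpen_apply_mem p J) using 1
    ext t
    refine ⟨fun h => ⟨Set.image_subset_iff.2 fun x hx => h x (lt_asymm (α := ℚ) hx),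
      h p (lt_irrefl p)⟩, fun h x hx => ?_⟩
    rcases (not_lt.1 hx : p ≤ x).lt_or_eq with h' | rfl
    exacts [Set.image_subset_iff.1 h.1 (Set.mem_Ioi.2 h'), h.2]
  · convert himg p using 1
    ext t
    simp [imageSet, Set.subset_def]

end RichTopology

/-! ### Stability of the factorization near `s`. -/

section OpenConditions

variable {f g : ℚ → ℚ} (hfg : IsOpenFiberSection f g)
include hfg

theorem IsOpenFiberSection.setOf_ge (q : ℚ) :
    {u | q ≤ g u} = Set.Ioi (f q) ∨ {u | q ≤ g u} = Set.Ici (f q) := by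
  refine (hfg.setOf_lt q).symm.imp (fun h => ?_) fun h => ?_
  · rw [← Set.compl_Iic, ← h]; ext; simp
  · rw [← Set.compl_Iio, ← h]; ext; simp

theorem IsOpenFiberSection.setOf_gt (q : ℚ) :
    {u | q < g u} = Set.Ioi (f q) ∨ {u | q < g u} = Set.Ici (f q) := by
  refine (hfg.setOf_le q).symm.imp (fun h => ?_) fun h => ?_
  · rw [← Set.compl_Iic, ← h]; ext; simp
  · rw [← Set.compl_Iio, ← h]; ext; simp

theorem isOpen_forall_mem_le {G : Set ℚ} (hG : IsRationalCut G) (q : ℚ) :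
    IsOpen[richTopology] {t : MQ | ∀ x ∈ G, g (t x) ≤ q} :=
  isOpen_forall_mem hG (J := {u | g u ≤ q}) (hfg.setOf_le q)

theorem isOpen_forall_notMem_ge {G : Set ℚ} (hG : IsRationalCut G) (q : ℚ) :
    IsOpen[richTopology] {t : MQ | ∀ x ∉ G, q ≤ g (t x)} :=
  isOpen_forall_notMem hG (J := {u | q ≤ g u}) (hfg.setOf_ge q)

theorem isOpen_forall_not_between (q q' : ℚ) :
    IsOpen[richTopology] {t : MQ | ∀ x, ¬ (q < g (t x) ∧ g (t x) < q')} := by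
  let _ : TopologicalSpace MQ := richTopology
  rcases le_or_gt q q' with h | h
  · have := isOpen_avoidSet (isRationalInterval_inter (hfg.monotone h) (hfg.setOf_gt q)
      (hfg.setOf_lt q'))
    rwa [avoidSet_eq] at this
  · convert isOpen_univ (X := MQ)
    ext t
    simp only [Set.mem_univ, iff_true]
    exact fun x hx => (hx.1.trans hx.2).not_gt h

/-- The image under `g` of an irrational cut may be moved within small limits so that it fits to
the maps `t` near `s`. -/
theorem exists_isOpen_isCompatible (s : MQ) {γ ε : ℝ} (hγ : Irrational γ) (hε : Irrational ε)
    (hεγ : ∀ x : ℚ, (g x : ℝ) < ε ↔ (x : ℝ) < γ) (X Q : Finset ℚ)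
    (hQ : ∀ q ∈ Q, ∀ x : ℚ, ((x : ℝ) < γ → g (s x) ≤ q) ∧ (γ < x → q ≤ g (s x))) :
    ∃ O : Set MQ, IsOpen[richTopology] O ∧ s ∈ O ∧ ∀ t ∈ O, ∃ ε' : ℝ,
      IsCompatible g (fun x => g (t x)) ε' ∧ (∀ v ∈ X, (v : ℝ) < ε' ↔ (v : ℝ) < ε) ∧
      ∀ q ∈ Q, ∀ x, ((g x : ℝ) < ε' → g (t x) ≤ q) ∧ (ε' < g x → q ≤ g (t x)) := by
  classical
  let _ : TopologicalSpace MQ := richTopology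
  have hl : ∀ v : ℚ, (v : ℝ) < ε → (f v : ℝ) < γ := by
    intro v hv
    refine (hγ.lt_or_gt_rat _).resolve_right fun h => ?_
    obtain ⟨x, hx, hx'⟩ := exists_rat_btwn h
    have := hfg.lt_of_lt_apply (Rat.cast_lt.1 hx')
    exact hx.not_gt ((hεγ x).1 ((Rat.cast_lt.2 this).trans hv))
  have hr : ∀ v : ℚ, ε < v → γ < f v := by
    intro v hv
    refine (hγ.lt_or_gt_rat _).resolve_left fun h => ?_
    obtain ⟨x, hx, hx'⟩ := exists_rat_btwn h
    have := hfg.lt_of_apply_lt (Rat.cast_lt.1 hx)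
    exact hv.not_gt ((Rat.cast_lt.2 this).trans ((hεγ x).2 hx'))
  obtain ⟨x₁, hx₁, hx₁γ⟩ : ∃ x₁ : ℚ, (∀ v ∈ X, (v : ℝ) < ε → v < g x₁) ∧ (x₁ : ℝ) < γ := by
    obtain ⟨r, hr1, hr2⟩ := Order.exists_between_finsets
      ((X.filter fun v : ℚ => (v : ℝ) < ε).image fun v => (f v : ℝ)) {γ} (by
        simp only [Finset.mem_image, Finset.mem_filter, Finset.mem_singleton]
        rintro _ ⟨v, ⟨-, hv⟩, rfl⟩ _ rfl
        exact hl v hv)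
    obtain ⟨x₁, h1, h2⟩ := exists_rat_btwn (hr2 γ (by simp))
    refine ⟨x₁, fun v hv hvε => hfg.lt_of_apply_lt (Rat.cast_lt.1 ((hr1 _ ?_).trans h1)), h2⟩
    exact Finset.mem_image_of_mem _ (Finset.mem_filter.2 ⟨hv, hvε⟩)
  obtain ⟨x₂, hx₂, hx₂γ⟩ : ∃ x₂ : ℚ, (∀ v ∈ X, ε < v → g x₂ < v) ∧ γ < x₂ := by
    obtain ⟨r, hr1, hr2⟩ := Order.exists_between_finsets {γ}
      ((X.filter fun v : ℚ => ε < v).image fun v => (f v : ℝ)) (by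
        simp only [Finset.mem_image, Finset.mem_filter, Finset.mem_singleton]
        rintro _ rfl _ ⟨v, ⟨-, hv⟩, rfl⟩
        exact hr v hv)
    obtain ⟨x₁, h1, h2⟩ := exists_rat_btwn (hr1 γ (by simp))
    refine ⟨x₁, fun v hv hvε => hfg.lt_of_lt_apply (Rat.cast_lt.1 (h2.trans (hr2 _ ?_))), h1⟩
    exact Finset.mem_image_of_mem _ (Finset.mem_filter.2 ⟨hv, hvε⟩)
  have hx₁₂ : x₁ < x₂ := by exact_mod_cast hx₁γ.trans hx₂γ
  -- Fixing `t` at `x₁ < γ < x₂` confines the new cut to a region where `g` meets no point of `X` on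
  -- the wrong side. The avoidance conditions make `g ∘ t` cross all of `Q` at a single cut.
  refine ⟨pointSet x₁ (s x₁) ∩ pointSet x₂ (s x₂) ∩
    ⋂ c ∈ Q ×ˢ Q, {t : MQ | ∀ x, ¬ (c.1 < g (t x) ∧ g (t x) < c.2)},
    ((isOpen_pointSet _ _).inter (isOpen_pointSet _ _)).inter
      (isOpen_biInter_finset fun c _ => isOpen_forall_not_between hfg c.1 c.2),
    ⟨⟨rfl, rfl⟩, ?_⟩, ?_⟩
  · simp only [Set.mem_iInter, Finset.mem_product]
    rintro c ⟨h1, h2⟩ x ⟨h3, h4⟩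
    rcases hγ.lt_or_gt_rat x with h | h
    · exact ((hQ _ h1 x).1 h).not_gt h3
    · exact ((hQ _ h2 x).2 h).not_gt h4
  rintro t ⟨⟨ht₁, ht₂⟩, ht⟩
  replace ht : ∀ q ∈ Q, ∀ q' ∈ Q, ∀ x, q < g (t x) → q' ≤ g (t x) := by
    intro q hq q' hq' x h
    simp only [Set.mem_iInter, Finset.mem_product] at ht
    by_contra! h'
    exact ht (q, q') ⟨hq, hq'⟩ x ⟨h, h'⟩
  have hτ : Monotone fun x => g (t x) := hfg.strictMono_section.monotone.comp t.monotone
  -- The new cut: between `x₁` and `x₂`, the points where `g ∘ t` has not yet exceeded any element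
  -- of `Q`.
  set Λ : Set ℚ := {x | x ≤ x₁ ∨ (x < x₂ ∧ ∀ q ∈ Q, g (t x) ≤ q)} with hΛ
  have hΛlow : IsLowerSet Λ := by
    rintro x y hyx (h | ⟨h1, h2⟩)
    · exact .inl (hyx.trans h)
    · exact .inr ⟨hyx.trans_lt h1, fun q hq => (hτ hyx).trans (h2 q hq)⟩
  have hx₁Λ : x₁ ∈ Λ := .inl le_rfl
  have hx₂Λ : x₂ ∉ Λ := by
    rintro (h | ⟨h, -⟩)
    exacts [h.not_gt hx₁₂, lt_irrefl _ h]
  have hleft : ∀ q ∈ Q, ∀ x ∈ Λ, g (t x) ≤ q := by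
    rintro q hq x (h | ⟨-, h⟩)
    · refine (hτ h).trans ?_
      have := (hQ q hq x₁).1 hx₁γ
      rwa [← show t x₁ = s x₁ from ht₁] at this
    · exact h q hq
  have hmid : ∀ x ∉ Λ, x < x₂ → ∃ q ∈ Q, q < g (t x) := by
    intro x hx hx2
    by_contra! h
    exact hx (.inr ⟨hx2, h⟩)
  have hright : ∀ q ∈ Q, ∀ x ∉ Λ, q ≤ g (t x) := by
    intro q hq x hx
    rcases lt_or_ge x x₂ with h | h
    · obtain ⟨q', hq', h'⟩ := hmid x hx h
      exact ht q' hq' q hq x h'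
    · refine le_trans ?_ (hτ h)
      have := (hQ q hq x₂).2 hx₂γ
      rwa [← show t x₂ = s x₂ from ht₂] at this
  suffices h : ∃ ε' : ℝ, IsCompatible g (fun x => g (t x)) ε' ∧
      ∀ x, (g x : ℝ) < ε' ↔ x ∈ Λ by
    obtain ⟨ε', hε', hΛε⟩ := h
    refine ⟨ε', hε', fun v hv => ⟨fun h => ?_, fun h => ?_⟩, fun q hq x =>
      ⟨fun h => hleft q hq x ((hΛε x).1 h), fun h => hright q hq x fun h' =>
        h.not_gt ((hΛε x).2 h')⟩⟩
    · refine (hε.lt_or_gt_rat v).resolve_right fun h' => hx₂Λ ((hΛε _).1 ?_)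
      exact (Rat.cast_lt.2 (hx₂ v hv h')).trans h
    · exact (Rat.cast_lt.2 (hx₁ v hv h)).trans ((hΛε _).2 hx₁Λ)
  -- If `Λ` is an irrational cut, it is a gap of `g ∘ t`, witnessed by a rational just above the
  -- least element of `Q`, where isolation leaves room. Otherwise a hole of the image of `g` next to
  -- the extremal point provides `ε'`.
  by_cases hmax : ∀ x ∈ Λ, ∃ x' ∈ Λ, x < x'
  · by_cases hmin : ∀ x ∉ Λ, ∃ x' ∉ Λ, x' < x
    · obtain ⟨γ', hγ', hΛγ⟩ := exists_irrational_cut hΛlow ⟨_, hx₁Λ⟩ ⟨_, hx₂Λ⟩ hmax hmin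
      have hΛγ' : ∀ x : ℚ, γ' < x → x ∉ Λ := fun x h h' => h.not_gt ((hΛγ x).1 h')
      obtain ⟨ε', hε', hε''⟩ := hfg.exists_extension hγ'
      refine ⟨ε', ⟨hε', .inr ⟨γ', ⟨hγ', ?_⟩, hε''⟩⟩, fun x => (hε'' x).trans (hΛγ x).symm⟩
      have hQne : Q.Nonempty := by
        obtain ⟨x, hx, hx2⟩ := hmin x₂ hx₂Λ
        obtain ⟨q, hq, -⟩ := hmid x hx hx2
        exact ⟨q, hq⟩
      have hgt : ∀ x ∉ Λ, Q.min' hQne < g (t x) := by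
        intro x hx
        rcases lt_or_ge x x₂ with h | h
        · obtain ⟨q', hq', h'⟩ := hmid x hx h
          exact (Q.min'_le q' hq').trans_lt h'
        · obtain ⟨x', hx', hx2⟩ := hmin x₂ hx₂Λ
          obtain ⟨q', hq', h'⟩ := hmid x' hx' hx2
          exact (Q.min'_le q' hq').trans_lt (h'.trans_le (hτ (hx2.le.trans h)))
      obtain ⟨q₁, q₂, hq₁, hq₂, hiso⟩ := hfg.hasIsolatedImage (Q.min' hQne)
      obtain ⟨y, hy1, hy2⟩ := exists_between hq₂
      refine ⟨y, fun x => ⟨fun h => ?_, fun h => ?_⟩⟩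
      · exact (hleft _ (Q.min'_mem hQne) x ((hΛγ x).2 h)).trans_lt hy1
      · have h' := hgt x (hΛγ' x h)
        by_contra! h''
        exact h'.ne' (hiso _ (hq₁.trans h') (h''.trans_lt hy2))
    · push Not at hmin
      obtain ⟨m, hm, hmin⟩ := hmin
      obtain ⟨ε', hε', h⟩ := exists_isCompatible_lt hfg.hasIsolatedImage (fun x => g (t x)) (g m)
      refine ⟨ε', hε', fun x => (h x).trans (hfg.strictMono_section.lt_iff_lt.trans ?_)⟩
      exact ⟨fun h => by_contra fun h' => (hmin x h').not_gt h,
        fun h => not_le.1 fun h' => hm (hΛlow h' h)⟩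
  · push Not at hmax
    obtain ⟨m, hm, hmax⟩ := hmax
    obtain ⟨y, hy⟩ := exists_rat_gt (g m : ℝ)
    obtain ⟨ε', hε', -, -, h⟩ := exists_isCompatible_between hfg.hasIsolatedImage
      (fun x => g (t x)) hy
    refine ⟨ε', hε', fun x => (h x).trans (hfg.strictMono_section.le_iff_le.trans ?_)⟩
    exact ⟨fun h => hΛlow h hm, hmax x⟩

/-- Each `y ∈ Y` is treated by the dichotomy above. In the rational case `b'` is frozen on finitely
many points; in the gap case `b'` is told to send a displaced irrational `ε' d` to the gap `d`. With
these finite prescriptions `b'` and then `a'` are constructed as before, now for `g ∘ t`. -/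
theorem exists_isOpen_factorization {h : ℚ → ℚ} (hh : StrictMono h) (hhi : HasIsolatedImage h)
    (hdense : ∀ x y : ℝ, x < y → ∃ δ ∈ gaps h, x < δ ∧ δ < y) {s : MQ} {a b : ℚ ≃o ℚ}
    (hs : ∀ x, f (a (h (b (g x)))) = g (s x))
    (hb : ∀ δ ∈ gaps h, ∃ ε, IsCompatible g (fun x => g (s x)) ε ∧
      ∀ q : ℚ, (q : ℝ) < ε ↔ (b q : ℝ) < δ)
    {C : Set MQ} (hC : IsOpen[richTopology] C) (hsC : s ∈ C)
    (hCl : ∀ t ∈ C, (∃ y, ∀ x, y < h x) ↔ ∃ q, ∀ x, q < g (t x))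
    (hCu : ∀ t ∈ C, (∃ y, ∀ x, h x < y) ↔ ∃ q, ∀ x, g (t x) < q) (Y X : Finset ℚ) :
    ∃ O : Set MQ, IsOpen[richTopology] O ∧ s ∈ O ∧ ∀ t ∈ O, ∃ a' b' : ℚ ≃o ℚ,
      (∀ y ∈ Y, a' y = a y) ∧ (∀ v ∈ X, b' v = b v) ∧
      ∀ x, f (a' (h (b' (g x)))) = g (t x) := by
  classical
  let _ : TopologicalSpace MQ := richTopology
  have hk : StrictMono fun x => h (b (g x)) := fun x x' hx =>
    hh (b.strictMono (hfg.strictMono_section hx))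
  set R : ℚ → Prop := fun y => ∃ F : Finset ℚ, ∃ G₁ G₂ : Set ℚ,
    IsRationalCut G₁ ∧ IsRationalCut G₂ ∧ ∀ b' : ℚ ≃o ℚ, (∀ v ∈ F, b' v = b v) →
        ∀ x, (h (b' (g x)) < y ↔ x ∈ G₁) ∧ (y < h (b' (g x)) ↔ x ∉ G₂) with hR
  choose! F G₁ G₂ hG₁ hG₂ hF using fun y (hy : R y) => hy
  choose! δ hδ hδy γ hγ hγδ using fun y (hy : ¬ R y) =>
    (exists_isRationalCut_or_gap hfg hh hb y).resolve_left hy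
  choose! ε hε hεδ using hb
  choose! σ hσ₁ hσ₂ using fun (x y : ℝ) (hxy : x < y) => exists_rat_btwn hxy
  -- Several `y` may lie in the same gap; they must share one displaced cut, so they are grouped by
  -- gap.
  set Δ : Finset ℝ := (Y.filter fun y => ¬ R y).image δ with hΔ
  have hΔgap : ∀ d ∈ Δ, d ∈ gaps h := by
    intro d hd
    obtain ⟨y, hy, rfl⟩ := Finset.mem_image.1 hd
    exact hδ y (Finset.mem_filter.1 hy).2
  -- The last part puts a frozen point between any two gaps in `Δ`, which keeps their displaced cuts
  -- in the same order.
  set X' : Finset ℚ := X ∪ (Y.filter R).biUnion F ∪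
    (Δ ×ˢ Δ).image fun c => b.symm (σ c.1 c.2) with hX'
  have hFX : ∀ y ∈ Y, R y → F y ⊆ X' := fun y hy hRy => by
    refine Finset.subset_union_left.trans' (Finset.subset_union_right.trans' ?_)
    exact Finset.subset_biUnion_of_mem F (Finset.mem_filter.2 ⟨hy, hRy⟩)
  have hirr : ∀ d ∈ Δ, ∃ O : Set MQ, IsOpen[richTopology] O ∧ s ∈ O ∧ ∀ t ∈ O, ∃ ε' : ℝ,
      IsCompatible g (fun x => g (t x)) ε' ∧ (∀ v ∈ X', (v : ℝ) < ε' ↔ (v : ℝ) < ε d) ∧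
      ∀ q ∈ (Y.filter fun y => ¬ R y ∧ δ y = d).image fun y => f (a y),
        ∀ x, ((g x : ℝ) < ε' → g (t x) ≤ q) ∧ (ε' < g x → q ≤ g (t x)) := by
    intro d hd
    obtain ⟨y₀, hy₀, rfl⟩ := Finset.mem_image.1 hd
    have hy₀R := (Finset.mem_filter.1 hy₀).2
    have hgap := hδ y₀ hy₀R
    refine exists_isOpen_isCompatible hfg s (hγ y₀ hy₀R).1 (hε _ hgap).1
      (fun x => (hεδ _ hgap _).trans (hγδ y₀ hy₀R x)) X' _ fun q hq x => ?_
    obtain ⟨y, hy, rfl⟩ := Finset.mem_image.1 hq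
    obtain ⟨-, hyR, hyd⟩ := Finset.mem_filter.1 hy
    have h1 := hδy y hyR (b (g x))
    rw [hyd] at h1
    have h2 := hγδ y₀ hy₀R x
    constructor
    · intro hx
      rw [← hs]
      exact hfg.monotone (a.monotone (h1.1.2 (h2.2 hx)).le)
    · intro hx
      rw [← hs]
      refine hfg.monotone (a.monotone (h1.2.2 ?_).le)
      exact (hgap.1.lt_or_gt_rat _).resolve_left fun h => hx.not_gt (h2.1 h)
  choose! O₂ hO₂ hsO₂ hO₂' using hirr
  have hrat : ∀ y, R y → ∃ O : Set MQ, IsOpen[richTopology] O ∧ s ∈ O ∧ ∀ t ∈ O, ∀ x,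
      (x ∈ G₁ y → g (t x) ≤ f (a y)) ∧ (x ∉ G₂ y → f (a y) ≤ g (t x)) ∧
        (x ∉ G₁ y → x ∈ G₂ y → g (t x) = f (a y)) := by
    intro y hy
    have hcut := hF y hy b fun _ _ => rfl
    have heq : ∀ x, x ∉ G₁ y → x ∈ G₂ y → h (b (g x)) = y := fun x h1 h2 =>
      le_antisymm (not_lt.1 fun h' => (hcut x).2.1 h' h2) (not_lt.1 fun h' => h1 ((hcut x).1.1 h'))
    have hsl : s ∈ {t : MQ | ∀ x ∈ G₁ y, g (t x) ≤ f (a y)} := fun x hx => by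
      rw [← hs]
      exact hfg.monotone (a.monotone ((hcut x).1.2 hx).le)
    have hsu : s ∈ {t : MQ | ∀ x ∉ G₂ y, f (a y) ≤ g (t x)} := fun x hx => by
      rw [← hs]
      exact hfg.monotone (a.monotone ((hcut x).2.2 hx).le)
    have hopen := (isOpen_forall_mem_le hfg (hG₁ y hy) (f (a y))).inter
      (isOpen_forall_notMem_ge hfg (hG₂ y hy) (f (a y)))
    -- At most one `x` has `h (b (g x)) = y`, so fixing one value of `t` secures the equality
    -- clause.
    by_cases hex : ∃ x, x ∉ G₁ y ∧ x ∈ G₂ y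
    · obtain ⟨x₀, h1, h2⟩ := hex
      refine ⟨_, hopen.inter (isOpen_pointSet x₀ (s x₀)), ⟨⟨hsl, hsu⟩, rfl⟩,
        fun t ht x => ⟨ht.1.1 x, ht.1.2 x, fun h3 h4 => ?_⟩⟩
      obtain rfl : x = x₀ := hk.injective ((heq x h3 h4).trans (heq x₀ h1 h2).symm)
      rw [show t x = s x from ht.2, ← hs, heq x h1 h2]
    · exact ⟨_, hopen, ⟨hsl, hsu⟩, fun t ht x =>
        ⟨ht.1 x, ht.2 x, fun h3 h4 => (hex ⟨x, h3, h4⟩).elim⟩⟩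
  choose! O₁ hO₁ hsO₁ hO₁' using hrat
  refine ⟨C ∩ (⋂ y ∈ Y.filter R, O₁ y) ∩ ⋂ d ∈ Δ, O₂ d,
    (hC.inter (isOpen_biInter_finset fun y hy => hO₁ y (Finset.mem_filter.1 hy).2)).inter
      (isOpen_biInter_finset fun d hd => hO₂ d hd),
    ⟨⟨hsC, Set.mem_iInter₂.2 fun y hy => hsO₁ y (Finset.mem_filter.1 hy).2⟩,
      Set.mem_iInter₂.2 fun d hd => hsO₂ d hd⟩, ?_⟩
  rintro t ⟨⟨htC, ht₁⟩, ht₂⟩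
  rw [Set.mem_iInter₂] at ht₁ ht₂
  choose! ε' hε' hX'ε hQε using fun d (hd : d ∈ Δ) => hO₂' d hd t (ht₂ d hd)
  have hside : ∀ v ∈ X', ∀ d ∈ Δ, ((v : ℝ) < ε' d ↔ (b v : ℝ) < d) ∧
      (ε' d < v ↔ d < b v) := by
    intro v hv d hd
    have h1 : (v : ℝ) < ε' d ↔ (b v : ℝ) < d := (hX'ε d hd v hv).trans (hεδ d (hΔgap d hd) v)
    refine ⟨h1, ?_⟩
    rw [lt_iff_le_and_ne, lt_iff_le_and_ne, ← not_lt, ← not_lt, h1]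
    have h2 : ε' d ≠ v := fun h' => (hε' d hd).1 ⟨v, h'.symm⟩
    have h3 : d ≠ b v := fun h' => (hΔgap d hd).1 ⟨b v, h'.symm⟩
    simp [h2, h3]
  have hmono : ∀ d ∈ Δ, ∀ d' ∈ Δ, d < d' → ε' d < ε' d' := by
    intro d hd d' hd' hlt
    have hv : b.symm (σ d d') ∈ X' := Finset.mem_union_right _
      (Finset.mem_image.2 ⟨(d, d'), Finset.mem_product.2 ⟨hd, hd'⟩, rfl⟩)
    have h1 := (hside _ hv d hd).2.2 (by simpa using hσ₁ d d' hlt)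
    have h2 := (hside _ hv d' hd').1.2 (by simpa using hσ₂ d d' hlt)
    exact h1.trans h2
  obtain ⟨b', hb'p, -, hb'gap⟩ := exists_automorphism_gaps_eq (τ := fun x => g (t x)) hfg hh hdense
    (p := X'.image (fun v : ℚ => ((v : ℝ), (b v : ℝ))) ∪ Δ.image fun d => (ε' d, d)) (by
      constructor
      · intro c hc
        rcases Finset.mem_union.1 hc with hc | hc
        · obtain ⟨v, hv, rfl⟩ := Finset.mem_image.1 hc
          exact .inl ⟨⟨v, rfl⟩, b v, rfl⟩
        · obtain ⟨d, hd, rfl⟩ := Finset.mem_image.1 hc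
          exact .inr ⟨hε' d hd, hΔgap d hd⟩
      · intro c hc c' hc'
        rcases Finset.mem_union.1 hc with hc | hc <;> rcases Finset.mem_union.1 hc' with hc' | hc'
        · obtain ⟨v, hv, rfl⟩ := Finset.mem_image.1 hc
          obtain ⟨v', hv', rfl⟩ := Finset.mem_image.1 hc'
          simp
        · obtain ⟨v, hv, rfl⟩ := Finset.mem_image.1 hc
          obtain ⟨d, hd, rfl⟩ := Finset.mem_image.1 hc'
          exact (hside v hv d hd).1
        · obtain ⟨v, hv, rfl⟩ := Finset.mem_image.1 hc'
          obtain ⟨d, hd, rfl⟩ := Finset.mem_image.1 hc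
          exact (hside v hv d hd).2
        · obtain ⟨d, hd, rfl⟩ := Finset.mem_image.1 hc
          obtain ⟨d', hd', rfl⟩ := Finset.mem_image.1 hc'
          refine ⟨fun hlt => ?_, hmono d hd d' hd'⟩
          rcases lt_trichotomy d d' with h' | rfl | h'
          exacts [h', (lt_irrefl _ hlt).elim, ((hmono d' hd' d hd h').not_gt hlt).elim])
  have hbX : ∀ v ∈ X', b' v = b v := by
    intro v hv
    have hlt := fun q => hb'p _ (Finset.mem_union_left _ (Finset.mem_image_of_mem _ hv)) q
    simp only [Rat.cast_lt] at hlt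
    refine le_antisymm (not_lt.1 fun h' => ?_) (not_lt.1 fun h' => lt_irrefl _ ((hlt v).2 h'))
    have := (hlt (b'.symm (b v))).1 (by rwa [← b'.lt_iff_lt, b'.apply_symm_apply])
    simp at this
  obtain ⟨a', ha', ha't⟩ := exists_automorphism_of_gaps_eq (τ := fun x => g (t x)) hfg hh hhi
    (hfg.strictMono_section.monotone.comp t.monotone) hb'gap (hCl t htC) (hCu t htC)
    (p := Y.image fun y => (y, a y)) (by
      constructor
      · intro c hc x
        obtain ⟨y, hy, rfl⟩ := Finset.mem_image.1 hc
        by_cases hRy : R y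
        · have h1 := hF y hRy b' (fun v hv => hbX v (hFX y hy hRy hv)) x
          obtain ⟨h2, h3, h4⟩ := hO₁' y hRy t (ht₁ y (Finset.mem_filter.2 ⟨hy, hRy⟩)) x
          refine ⟨fun h' => h2 (h1.1.1 h'), fun h' => h3 (h1.2.1 h'), fun h' => h4 ?_ ?_⟩
          · exact fun h5 => (h1.1.2 h5).ne h'
          · exact by_contra fun h5 => (h1.2.2 h5).ne' h'
        · have hd : δ y ∈ Δ := Finset.mem_image_of_mem _ (Finset.mem_filter.2 ⟨hy, hRy⟩)
          have h1 := hδy y hRy (b' (g x))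
          have h2 := hQε _ hd (f (a y)) (Finset.mem_image.2
            ⟨y, Finset.mem_filter.2 ⟨hy, hRy, rfl⟩, rfl⟩) x
          have h3 := hb'p _ (Finset.mem_union_right _ (Finset.mem_image_of_mem _ hd)) (g x)
          refine ⟨fun h' => h2.1 (h3.2 (h1.1.1 h')), fun h' => h2.2 ?_, fun h' => ?_⟩
          · refine ((hε' _ hd).1.lt_or_gt_rat _).resolve_left fun h4 => ?_
            exact (h1.2.1 h').not_gt (h3.1 h4)
          · rcases (hδ y hRy).1.lt_or_gt_rat (b' (g x)) with h4 | h4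
            · exact ((h1.1.2 h4).ne h').elim
            · exact ((h1.2.2 h4).ne' h').elim
      · intro c hc c' hc'
        obtain ⟨y, hy, rfl⟩ := Finset.mem_image.1 hc
        obtain ⟨y', hy', rfl⟩ := Finset.mem_image.1 hc'
        exact a.lt_iff_lt.symm)
  exact ⟨a', b', fun y hy => ha' _ (Finset.mem_image_of_mem _ hy),
    fun v hv => hbX v (Finset.mem_union_left _ (Finset.mem_union_left _ hv)), ha't⟩

end OpenConditions

/-! ### Constructing `f`, `g` and `h` from lexicographic products. -/

section LexProduct

variable {T : Type*} [LinearOrder T]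

/-- Each column meets the image in at most the point of height `0`, so an interval inside the column
of `q`, short enough to avoid height `0` unless `q` has it, suffices. -/
theorem hasIsolatedImage_lex (Φ : T ×ₗ ℚ ≃o ℚ) (ψ : ℚ → T) :
    HasIsolatedImage fun x => Φ (toLex (ψ x, 0)) := by
  intro q
  obtain ⟨t, r, rfl⟩ : ∃ t r, q = Φ (toLex (t, r)) :=
    ⟨(ofLex (Φ.symm q)).1, (ofLex (Φ.symm q)).2, by simp⟩
  obtain ⟨r₁, r₂, h1, h2, h3⟩ : ∃ r₁ r₂ : ℚ, r₁ < r ∧ r < r₂ ∧ (r₁ < 0 → 0 < r₂ → r = 0) := by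
    rcases lt_trichotomy r 0 with h | h | h
    · exact ⟨r - 1, r / 2, by linarith, by linarith, fun _ _ => by linarith⟩
    · exact ⟨-1, 1, by linarith, by linarith, fun _ _ => h⟩
    · exact ⟨r / 2, r + 1, by linarith, by linarith, fun _ _ => by linarith⟩
  refine ⟨Φ (toLex (t, r₁)), Φ (toLex (t, r₂)), ?_, ?_, fun x hx1 hx2 => ?_⟩
  · simpa [Prod.Lex.toLex_lt_toLex] using h1
  · simpa [Prod.Lex.toLex_lt_toLex] using h2
  · simp only [OrderIso.lt_iff_lt, Prod.Lex.toLex_lt_toLex] at hx1 hx2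
    have : ψ x = t ∧ r = 0 := by
      rcases hx1 with hx1 | ⟨e, hx1⟩
      · rcases hx2 with hx2 | ⟨e', -⟩
        exacts [(hx1.not_gt hx2).elim, (hx1.ne' e').elim]
      · rcases hx2 with hx2 | ⟨-, hx2⟩
        exacts [(hx2.ne' e).elim, ⟨e.symm, h3 hx1 hx2⟩]
    simp [this.1, this.2]

theorem strictMono_lex (Φ : T ×ₗ ℚ ≃o ℚ) {ψ : ℚ → T} (hψ : StrictMono ψ) :
    StrictMono fun x => Φ (toLex (ψ x, 0)) := fun _ _ h =>
  Φ.strictMono (Prod.Lex.toLex_lt_toLex.2 (.inl (hψ h)))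

/-- Cantor's theorem applies: the columns are copies of `ℚ`, so the product is countable, dense and
without endpoints. -/
theorem nonempty_lex_orderIso (T : Type*) [LinearOrder T] [Countable T] [Nonempty T] :
    Nonempty (T ×ₗ ℚ ≃o ℚ) := by
  have : Countable (T ×ₗ ℚ) := inferInstanceAs (Countable (T × ℚ))
  have : Nonempty (T ×ₗ ℚ) := inferInstanceAs (Nonempty (T × ℚ))
  exact Order.iso_of_countable_dense _ _

end LexProduct

theorem exists_isOpenFiberSection : ∃ f g : ℚ → ℚ, IsOpenFiberSection f g := by
  obtain ⟨Φ⟩ := nonempty_lex_orderIso ℚ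
  have key : ∀ t r r', r < r' → Φ (toLex (t, r)) < Φ (toLex (t, r')) := fun t r r' h =>
    Φ.strictMono (Prod.Lex.toLex_lt_toLex.2 (.inr ⟨rfl, h⟩))
  refine ⟨fun z => (ofLex (Φ.symm z)).1, fun x => Φ (toLex (x, 0)), ?_, fun x => by simp,
    fun z => ?_, fun z => ?_⟩
  · intro x y h
    exact Prod.Lex.monotone_fst _ _ (Φ.symm.monotone h)
  · refine ⟨Φ (toLex ((ofLex (Φ.symm z)).1, (ofLex (Φ.symm z)).2 - 1)), ?_, by simp⟩
    simpa using key (ofLex (Φ.symm z)).1 _ _ (sub_one_lt (ofLex (Φ.symm z)).2)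
  · refine ⟨Φ (toLex ((ofLex (Φ.symm z)).1, (ofLex (Φ.symm z)).2 + 1)), ?_, by simp⟩
    simpa using key (ofLex (Φ.symm z)).1 _ _ (lt_add_one (ofLex (Φ.symm z)).2)

/-- There is a sparse injection which is bounded below iff `A` and bounded above iff `B`. -/
theorem exists_sparse (A B : Prop) : ∃ h : ℚ → ℚ, StrictMono h ∧ HasIsolatedImage h ∧
    (∀ x y : ℝ, x < y → ∃ δ ∈ gaps h, x < δ ∧ δ < y) ∧
    ((∃ y, ∀ x, y < h x) ↔ A) ∧ ((∃ y, ∀ x, h x < y) ↔ B) := by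
  -- The map `h` uses only the columns over `ℚ`. The skipped columns over `q + √2` create a dense
  -- set of gaps; a column over `⊥` or `⊤` is present exactly when `h` is to be bounded on that
  -- side.
  set S : Set EReal := Set.range (fun q : ℚ => ((q : ℝ) : EReal)) ∪
    Set.range (fun q : ℚ => ((q + √2 : ℝ) : EReal)) ∪ ({t | A ∧ t = ⊥} ∪ {t | B ∧ t = ⊤}) with hS
  have hSc : S.Countable := by
    refine ((Set.countable_range _).union (Set.countable_range _)).union (.union ?_ ?_)
    · exact (Set.countable_singleton ⊥).mono fun t ht => ht.2
    · exact (Set.countable_singleton ⊤).mono fun t ht => ht.2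
  have := hSc.to_subtype
  set ψ : ℚ → S := fun q => ⟨((q : ℝ) : EReal), .inl (.inl ⟨q, rfl⟩)⟩ with hψ
  have hψm : StrictMono ψ := fun x y h => by
    simpa [hψ, ← Subtype.coe_lt_coe] using h
  have : Nonempty S := ⟨ψ 0⟩
  obtain ⟨Φ⟩ := nonempty_lex_orderIso S
  refine ⟨fun x => Φ (toLex (ψ x, 0)), strictMono_lex Φ hψm, hasIsolatedImage_lex Φ ψ, ?_, ?_, ?_⟩
  · intro x y hxy
    obtain ⟨q, hq1, hq2⟩ := exists_rat_btwn (sub_lt_sub_right hxy √2)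
    refine ⟨q + √2, ⟨irrational_sqrt_two.ratCast_add q, ?_⟩, by linarith, by linarith⟩
    refine ⟨Φ (toLex (⟨((q + √2 : ℝ) : EReal), .inl (.inr ⟨q, rfl⟩)⟩, 0)), fun x =>
      ⟨fun hx => Φ.strictMono (Prod.Lex.toLex_lt_toLex.2 (.inl ?_)),
        fun hx => Φ.strictMono (Prod.Lex.toLex_lt_toLex.2 (.inl ?_))⟩⟩
    · exact Subtype.coe_lt_coe.1 (EReal.coe_lt_coe_iff.2 hx)
    · exact Subtype.coe_lt_coe.1 (EReal.coe_lt_coe_iff.2 hx)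
  · constructor
    · rintro ⟨y, hy⟩
      by_contra hA
      obtain ⟨⟨t, ht⟩, r, rfl⟩ : ∃ t r, y = Φ (toLex (t, r)) :=
        ⟨(ofLex (Φ.symm y)).1, (ofLex (Φ.symm y)).2, by simp⟩
      have htb : ⊥ < t := by
        rcases ht with (⟨q, rfl⟩ | ⟨q, rfl⟩) | ⟨h, -⟩ | ⟨-, rfl⟩
        exacts [EReal.bot_lt_coe _, EReal.bot_lt_coe _, (hA h).elim, bot_lt_top]
      obtain ⟨q, -, hq⟩ := EReal.lt_iff_exists_rat_btwn.1 htb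
      refine (hy q).not_gt (Φ.strictMono (Prod.Lex.toLex_lt_toLex.2 (.inl ?_)))
      exact Subtype.coe_lt_coe.1 hq
    · intro hA
      refine ⟨Φ (toLex (⟨⊥, .inr (.inl ⟨hA, rfl⟩)⟩, 0)), fun x =>
        Φ.strictMono (Prod.Lex.toLex_lt_toLex.2 (.inl ?_))⟩
      exact Subtype.coe_lt_coe.1 (EReal.bot_lt_coe _)
  · constructor
    · rintro ⟨y, hy⟩
      by_contra hA
      obtain ⟨⟨t, ht⟩, r, rfl⟩ : ∃ t r, y = Φ (toLex (t, r)) :=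
        ⟨(ofLex (Φ.symm y)).1, (ofLex (Φ.symm y)).2, by simp⟩
      have htb : t < ⊤ := by
        rcases ht with (⟨q, rfl⟩ | ⟨q, rfl⟩) | ⟨-, rfl⟩ | ⟨h, -⟩
        exacts [EReal.coe_lt_top _, EReal.coe_lt_top _, bot_lt_top, (hA h).elim]
      obtain ⟨q, hq, -⟩ := EReal.lt_iff_exists_rat_btwn.1 htb
      refine (hy q).not_gt (Φ.strictMono (Prod.Lex.toLex_lt_toLex.2 (.inl ?_)))
      exact Subtype.coe_lt_coe.1 hq
    · intro hB
      refine ⟨Φ (toLex (⟨⊤, .inr (.inr ⟨hB, rfl⟩)⟩, 0)), fun x =>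
        Φ.strictMono (Prod.Lex.toLex_lt_toLex.2 (.inl ?_))⟩
      exact Subtype.coe_lt_coe.1 (EReal.coe_lt_top _)

/-! ### Boundedness classes, limit points and discontinuities. -/

section Classes

theorem infIm_eq_bot_iff (s : MQ) : infIm s = ⊥ ↔ ¬ ∃ q, ∀ x, q < s x := by
  rw [infIm, iInf_eq_bot]
  constructor
  · rintro h ⟨q, hq⟩
    obtain ⟨x, hx⟩ := h (q : ℝ) (EReal.bot_lt_coe _)
    exact (hq x).not_gt (by exact_mod_cast hx)
  · intro h c hc
    push Not at h
    obtain ⟨q, -, hq⟩ := EReal.lt_iff_exists_rat_btwn.1 hc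
    obtain ⟨x, hx⟩ := h q
    exact ⟨x, lt_of_le_of_lt (by exact_mod_cast hx) hq⟩

theorem supIm_eq_top_iff (s : MQ) : supIm s = ⊤ ↔ ¬ ∃ q, ∀ x, s x < q := by
  rw [supIm, iSup_eq_top]
  constructor
  · rintro h ⟨q, hq⟩
    obtain ⟨x, hx⟩ := h (q : ℝ) (EReal.coe_lt_top _)
    exact (hq x).not_gt (by exact_mod_cast hx)
  · intro h c hc
    push Not at h
    obtain ⟨q, hq, -⟩ := EReal.lt_iff_exists_rat_btwn.1 hc
    obtain ⟨x, hx⟩ := h q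
    exact ⟨x, lt_of_lt_of_le hq (by exact_mod_cast hx)⟩

theorem infIm_mem_finiteReals_iff (s : MQ) : infIm s ∈ finiteReals ↔ ∃ q, ∀ x, q < s x := by
  rw [← not_iff_not, ← infIm_eq_bot_iff]
  have htop : infIm s ≠ ⊤ := ne_top_of_le_ne_top (EReal.coe_ne_top _) (iInf_le _ (0 : ℚ))
  constructor
  · intro h
    by_contra hbot
    exact h ⟨(infIm s).toReal, EReal.coe_toReal htop hbot⟩
  · rintro h ⟨r, hr⟩
    exact EReal.coe_ne_bot r (hr.trans h)

theorem supIm_mem_finiteReals_iff (s : MQ) : supIm s ∈ finiteReals ↔ ∃ q, ∀ x, s x < q := by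
  rw [← not_iff_not, ← supIm_eq_top_iff]
  have hbot : supIm s ≠ ⊥ :=
    ne_bot_of_le_ne_bot (EReal.coe_ne_bot _) (le_iSup (fun x : ℚ => ((s x : ℝ) : EReal)) (0 : ℚ))
  constructor
  · intro h
    by_contra htop
    exact h ⟨(supIm s).toReal, EReal.coe_toReal htop hbot⟩
  · rintro h ⟨r, hr⟩
    exact EReal.coe_ne_top r (hr.trans h)

theorem bot_notMem_finiteReals : ⊥ ∉ finiteReals := fun ⟨r, hr⟩ => EReal.coe_ne_bot r hr

theorem top_notMem_finiteReals : ⊤ ∉ finiteReals := fun ⟨r, hr⟩ => EReal.coe_ne_top r hr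

theorem mem_boundednessSet_iff {L U : Set EReal} (hLU : IsBoundednessType L U) (s : MQ) :
    s ∈ boundednessSet L U ↔ ((∃ q, ∀ x, q < s x) ↔ L = finiteReals) ∧
      ((∃ q, ∀ x, s x < q) ↔ U = finiteReals) := by
  refine and_congr ?_ ?_
  · rcases hLU.1 with rfl | rfl
    · simp [infIm_mem_finiteReals_iff]
    · rw [Set.mem_singleton_iff, infIm_eq_bot_iff]
      have : ({⊥} : Set EReal) ≠ finiteReals := fun h =>
        bot_notMem_finiteReals (h ▸ Set.mem_singleton _)
      simp [this]
  · rcases hLU.2 with rfl | rfl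
    · simp [supIm_mem_finiteReals_iff]
    · rw [Set.mem_singleton_iff, supIm_eq_top_iff]
      have : ({⊤} : Set EReal) ≠ finiteReals := fun h =>
        top_notMem_finiteReals (h ▸ Set.mem_singleton _)
      simp [this]

theorem exists_mem_boundednessSet (s : MQ) :
    ∃ L U, IsBoundednessType L U ∧ s ∈ boundednessSet L U := by
  refine ⟨if infIm s = ⊥ then {⊥} else finiteReals, if supIm s = ⊤ then {⊤} else finiteReals,
    ⟨?_, ?_⟩, ?_, ?_⟩
  · split_ifs <;> simp
  · split_ifs <;> simp
  · split_ifs with h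
    · exact h
    · rwa [infIm_mem_finiteReals_iff, ← not_not (a := ∃ _, _), ← infIm_eq_bot_iff]
  · split_ifs with h
    · exact h
    · rwa [supIm_mem_finiteReals_iff, ← not_not (a := ∃ _, _), ← supIm_eq_top_iff]

theorem limitPoints_subset_irrational {s : MQ} (hs : HasIsolatedImage s) :
    limitPoints s ⊆ {γ | Irrational γ} := by
  rintro γ hγ ⟨q, rfl⟩
  obtain ⟨q₁, q₂, h1, h2, h⟩ := hs q
  have hU : Set.Ioo (q₁ : ℝ) q₂ ∈ 𝓝 (q : ℝ) :=
    Ioo_mem_nhds (by exact_mod_cast h1) (by exact_mod_cast h2)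
  obtain ⟨_, ⟨⟨h3, h4⟩, x, rfl⟩, hne⟩ := accPt_iff_nhds.1 hγ _ hU
  exact hne (congrArg _ (h x (Rat.cast_lt.1 h3) (Rat.cast_lt.1 h4)))

theorem leftSup_le {s : MQ} {γ c : ℝ} (h : ∀ x : ℚ, (x : ℝ) < γ → (s x : ℝ) ≤ c) :
    leftSup s γ ≤ c := by
  obtain ⟨l, hl⟩ := exists_rat_lt γ
  refine csSup_le ⟨_, l, hl, rfl⟩ ?_
  rintro _ ⟨x, hx, rfl⟩
  exact h x hx

theorem le_rightInf {s : MQ} {γ c : ℝ} (h : ∀ x : ℚ, γ < x → c ≤ (s x : ℝ)) :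
    c ≤ rightInf s γ := by
  obtain ⟨l, hl⟩ := exists_rat_gt γ
  refine le_csInf ⟨_, l, hl, rfl⟩ ?_
  rintro _ ⟨x, hx, rfl⟩
  exact h x hx

theorem irrDiscont_subset_gaps (s : MQ) : irrDiscont s ⊆ gaps s := by
  rintro γ ⟨hγ, hlt⟩
  obtain ⟨l, hl⟩ := exists_rat_lt γ
  obtain ⟨u, hu⟩ := exists_rat_gt γ
  have hle : ∀ x x' : ℚ, (x : ℝ) < γ → γ < x' → (s x : ℝ) ≤ s x' := fun x x' h h' =>
    Rat.cast_le.2 (s.monotone (Rat.cast_le.1 (h.trans h').le))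
  obtain ⟨y, hy1, hy2⟩ := exists_rat_btwn hlt
  refine ⟨hγ, y, fun x => ⟨fun hx => ?_, fun hx => ?_⟩⟩
  · have : (s x : ℝ) ≤ leftSup s γ := le_csSup
      ⟨s u, by rintro _ ⟨x', hx', rfl⟩; exact hle x' u hx' hu⟩ ⟨x, hx, rfl⟩
    exact_mod_cast this.trans_lt hy1
  · have : rightInf s γ ≤ s x := csInf_le
      ⟨s l, by rintro _ ⟨x', hx', rfl⟩; exact hle l x' hl hx'⟩ ⟨x, hx, rfl⟩
    exact_mod_cast hy2.trans_le this

/-- In general both one-sided limits at a gap could equal the separating rational `y`. Isolation at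
`y` keeps the values away from a whole interval around it, so the jump has positive length. -/
theorem gaps_subset_irrDiscont {s : MQ} (hs : HasIsolatedImage s) : gaps s ⊆ irrDiscont s := by
  rintro γ ⟨hγ, y, hy⟩
  obtain ⟨q₁, q₂, h1, h2, h⟩ := hs y
  refine ⟨hγ, (leftSup_le (c := q₁) fun x hx => ?_).trans_lt
    ((Rat.cast_lt.2 (h1.trans h2)).trans_le (le_rightInf (c := q₂) fun x hx => ?_))⟩
  · have h3 := (hy x).1 hx
    exact Rat.cast_le.2 (not_lt.1 fun h4 => h3.ne (h x h4 (h3.trans h2)))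
  · have h3 := (hy x).2 hx
    exact Rat.cast_le.2 (not_lt.1 fun h4 => h3.ne' (h x (h1.trans h3) h4))

end Classes

theorem pointwiseMQ_eq_induced :
    pointwiseMQ = TopologicalSpace.induced (fun (s : MQ) (x : ℚ) => s x)
      (@Pi.topologicalSpace ℚ (fun _ => ℚ) fun _ => ⊥) := by
  simp only [pointwiseMQ, Pi.topologicalSpace, induced_iInf, induced_compose]
  rfl

theorem exists_finset_of_isOpen_pointwiseGQ {V : Set GQ} (hV : IsOpen[pointwiseGQ] V) {a : GQ}
    (ha : a ∈ V) :
    ∃ Y : Finset ℚ, ∀ a' : GQ, (∀ y ∈ Y, (a' : MQ) y = (a : MQ) y) → a' ∈ V := by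
  rw [pointwiseGQ, pointwiseMQ_eq_induced, induced_compose] at hV
  obtain ⟨W, hW, rfl⟩ := hV
  obtain ⟨Y, u, hu, hYu⟩ := (@isOpen_pi_iff ℚ (fun _ => ℚ) (fun _ => ⊥) W).1 hW _ ha
  refine ⟨Y, fun a' ha' => hYu fun y hy => ?_⟩
  have := (hu y hy).2
  simp only [Function.comp_apply] at this ⊢
  rwa [ha' y hy]

theorem IsOpenFiberSection.isGenericInjection {f : ℚ → ℚ} {g : MQ}
    (hfg : IsOpenFiberSection f g) : IsGenericInjection g := by
  refine ⟨hfg.strictMono_section.injective, ⟨?_, ?_⟩, ?_,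
    limitPoints_subset_irrational hfg.hasIsolatedImage⟩
  · rw [Set.mem_singleton_iff, infIm_eq_bot_iff]
    rintro ⟨q, hq⟩
    exact (hq _).not_gt (hfg.lt_of_lt_apply (sub_one_lt (f q)))
  · rw [Set.mem_singleton_iff, supIm_eq_top_iff]
    rintro ⟨q, hq⟩
    exact (hq _).not_gt (hfg.lt_of_apply_lt (lt_add_one (f q)))
  · refine Set.eq_empty_of_forall_notMem fun γ hγ => ?_
    obtain ⟨hγ, y, hy⟩ := irrDiscont_subset_gaps g hγ
    exact hfg.not_separates hγ (fun x hx => ((hy x).1 hx).le) fun x hx => ((hy x).2 hx).le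

/-- The endpoints of the fibre of `q` are the cuts `f x < q` and `f x ≤ q`, irrational because
fibres have no endpoints in `ℚ`. -/
theorem IsOpenFiberSection.isGenericSurjection {f : MQ} {g : ℚ → ℚ}
    (hfg : IsOpenFiberSection f g) : IsGenericSurjection f := by
  refine ⟨hfg.surjective, fun q => ?_⟩
  obtain ⟨r, hr, hr'⟩ := exists_irrational_cut (X := {x | f x < q})
    (fun x y hyx hx => (f.monotone hyx).trans_lt hx)
    ⟨g (q - 1), by simp [hfg.apply_section]⟩ ⟨g q, by simp [hfg.apply_section]⟩
    (fun x hx => by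
      obtain ⟨x', h, e⟩ := hfg.exists_gt x
      exact ⟨x', e.trans_lt hx, h⟩)
    (fun x hx => by
      obtain ⟨x', h, e⟩ := hfg.exists_lt x
      exact ⟨x', fun h' => hx (e.symm.trans_lt h'), h⟩)
  obtain ⟨t, ht, ht'⟩ := exists_irrational_cut (X := {x | f x ≤ q})
    (fun x y hyx hx => (f.monotone hyx).trans hx)
    ⟨g q, by simp [hfg.apply_section]⟩ ⟨g (q + 1), by simp [hfg.apply_section]⟩
    (fun x hx => by
      obtain ⟨x', h, e⟩ := hfg.exists_gt x
      exact ⟨x', e.trans_le hx, h⟩)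
    (fun x hx => by
      obtain ⟨x', h, e⟩ := hfg.exists_lt x
      exact ⟨x', fun h' => hx (e.symm.trans_le h'), h⟩)
  refine ⟨r, t, hr, ht, Set.ext fun x => ?_⟩
  have h1 : f x < q ↔ (x : ℝ) < r := hr' x
  have h2 : f x ≤ q ↔ (x : ℝ) < t := ht' x
  change f x = q ↔ r < x ∧ (x : ℝ) < t
  rw [← h2, le_antisymm_iff, and_comm, ← not_lt (a := f x), h1]
  exact and_congr_left fun _ => ⟨(hr.lt_or_gt_rat x).resolve_left, fun h => h.not_gt⟩

theorem IsOpenFiberSection.exists_lt_iff {f g : ℚ → ℚ} (hfg : IsOpenFiberSection f g)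
    (t : ℚ → ℚ) : (∃ q, ∀ x, q < g (t x)) ↔ ∃ q, ∀ x, q < t x :=
  ⟨fun ⟨q, hq⟩ => ⟨f q - 1, fun x => (sub_one_lt _).trans_le (hfg.apply_le (hq x).le)⟩,
    fun ⟨q, hq⟩ => ⟨g q, fun x => hfg.strictMono_section (hq x)⟩⟩

theorem IsOpenFiberSection.exists_gt_iff {f g : ℚ → ℚ} (hfg : IsOpenFiberSection f g)
    (t : ℚ → ℚ) : (∃ q, ∀ x, g (t x) < q) ↔ ∃ q, ∀ x, t x < q :=
  ⟨fun ⟨q, hq⟩ => ⟨f q + 1, fun x => (hfg.le_apply (hq x).le).trans_lt (lt_add_one _)⟩,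
    fun ⟨q, hq⟩ => ⟨g q, fun x => hfg.strictMono_section (hq x)⟩⟩

/-! ### Assembling the factorization. -/

theorem exists_generic_factorization :
    ∃ e f g : MQ, IsGenericInjection e ∧ (∃ p : MQ, p * e = 1) ∧
      IsGenericSurjection f ∧ IsGenericInjection g ∧
      ∀ L U : Set EReal, IsBoundednessType L U →
        ∃ h ∈ boundednessSet L U, IsSparseInjection h ∧
          ∀ s ∈ boundednessSet L U, ∃ a b : GQ,
            e * s = f * (a : MQ) * h * (b : MQ) * g ∧
            ∀ V W : Set GQ, IsOpen[pointwiseGQ] V → IsOpen[pointwiseGQ] W → a ∈ V → b ∈ W →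
              ∃ O : Set MQ, IsOpen[richTopology] O ∧ s ∈ O ∧
                ∀ t ∈ O, ∃ a' ∈ V, ∃ b' ∈ W,
                  e * t = f * (a' : MQ) * h * (b' : MQ) * g := by
  obtain ⟨f, g, hfg⟩ := exists_isOpenFiberSection
  let fM : MQ := ⟨f, hfg.monotone⟩
  let gM : MQ := ⟨g, hfg.strictMono_section.monotone⟩
  have hfgM : IsOpenFiberSection fM gM := hfg
  refine ⟨gM, fM, gM, hfgM.isGenericInjection,
    ⟨fM, OrderHom.ext _ _ (funext fun x => hfg.apply_section x)⟩,
    hfgM.isGenericSurjection, hfgM.isGenericInjection, fun L U hLU => ?_⟩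
  obtain ⟨h, hh, hhi, hdense, hlow, hupp⟩ := exists_sparse (L = finiteReals) (U = finiteReals)
  let hM : MQ := ⟨h, hh.monotone⟩
  refine ⟨hM, (mem_boundednessSet_iff hLU hM).2 ⟨hlow, hupp⟩, ⟨hh.injective, ?_,
    limitPoints_subset_irrational (s := hM) hhi⟩, fun s hs => ?_⟩
  · refine (dense_of_exists_between fun x y hxy => ?_).mono (gaps_subset_irrDiscont (s := hM) hhi)
    exact hdense x y hxy
  -- Since `g` preserves and reflects boundedness, `h` and `g ∘ t` are bounded on the same sides for
  -- every `t` in the class; the class itself is rich-open.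
  have hCl : ∀ t ∈ boundednessSet L U, (∃ y, ∀ x, y < h x) ↔ ∃ q, ∀ x, q < g (t x) :=
    fun t ht => hlow.trans (((mem_boundednessSet_iff hLU t).1 ht).1.symm.trans
      (hfg.exists_lt_iff t).symm)
  have hCu : ∀ t ∈ boundednessSet L U, (∃ y, ∀ x, h x < y) ↔ ∃ q, ∀ x, g (t x) < q :=
    fun t ht => hupp.trans (((mem_boundednessSet_iff hLU t).1 ht).2.symm.trans
      (hfg.exists_gt_iff t).symm)
  obtain ⟨b, -, hb, hgap⟩ := exists_automorphism_gaps_eq (τ := fun x => g (s x)) hfg hh hdense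
    (p := ∅) ⟨by simp, by simp⟩
  obtain ⟨a, -, ha⟩ := exists_automorphism_of_gaps_eq (τ := fun x => g (s x)) hfg hh hhi
    (hfg.strictMono_section.monotone.comp s.monotone) hgap (hCl s hs) (hCu s hs)
    (p := ∅) ⟨by simp, by simp⟩
  refine ⟨⟨_, a, rfl⟩, ⟨_, b, rfl⟩, OrderHom.ext _ _ (funext fun x => (ha x).symm),
    fun V W hV hW haV hbW => ?_⟩
  obtain ⟨Y, hY⟩ := exists_finset_of_isOpen_pointwiseGQ hV haV
  obtain ⟨X, hX⟩ := exists_finset_of_isOpen_pointwiseGQ hW hbW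
  obtain ⟨O, hO, hsO, hO'⟩ := exists_isOpen_factorization hfg hh hhi hdense ha hb
    (isOpen_boundednessSet hLU) hs hCl hCu Y X
  refine ⟨O, hO, hsO, fun t ht => ?_⟩
  obtain ⟨a', b', ha', hb', hab⟩ := hO' t ht
  exact ⟨⟨_, a', rfl⟩, hY _ ha', ⟨_, b', rfl⟩, hX _ hb',
    OrderHom.ext _ _ (funext fun x => (hab x).symm)⟩

theorem altProd_two {S : Type*} [Monoid S] (h : Fin 3 → S) (a : Fin 2 → S) :
    altProd 2 h a = h 2 * a 1 * h 1 * a 0 * h 0 := by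
  simp only [altProd, mul_assoc]
  rfl

theorem mainTheorem2 :
    HasPseudoPropertyXBar richTopology GQ pointwiseGQ 2 ∧
    ∃ e f g : MQ, IsGenericInjection e ∧ (∃ p : MQ, p * e = 1) ∧
      IsGenericSurjection f ∧ IsGenericInjection g ∧
      ∀ L U : Set EReal, IsBoundednessType L U →
        ∃ h ∈ boundednessSet L U, IsSparseInjection h ∧
          ∀ s ∈ boundednessSet L U, ∃ a b : GQ,
            e * s = f * (a : MQ) * h * (b : MQ) * g ∧
            ∀ V W : Set GQ, IsOpen[pointwiseGQ] V → IsOpen[pointwiseGQ] W → a ∈ V → b ∈ W →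
              ∃ O : Set MQ, IsOpen[richTopology] O ∧ s ∈ O ∧
                ∀ t ∈ O, ∃ a' ∈ V, ∃ b' ∈ W,
                  e * t = f * (a' : MQ) * h * (b' : MQ) * g := by
  refine ⟨⟨by norm_num, fun s => ?_⟩, exists_generic_factorization⟩
  obtain ⟨e, f, g, -, he, -, -, H⟩ := exists_generic_factorization
  obtain ⟨L, U, hLU, hs⟩ := exists_mem_boundednessSet s
  obtain ⟨h, -, -, H⟩ := H L U hLU
  obtain ⟨a, b, hab, H⟩ := H s hs
  -- The factors of `altProd` are indexed from the right, so `g` and `b` come first and `W` is `V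
  -- 0`.
  refine ⟨e, ![g, h, f], ![b, a], he, by rw [altProd_two]; exact hab, fun V hV haV => ?_⟩
  obtain ⟨O, hO, hsO, hO'⟩ := H (V 1) (V 0) (hV 1) (hV 0) (haV 1) (haV 0)
  refine ⟨O, hO, hsO, ?_⟩
  rintro _ ⟨t, ht, rfl⟩
  obtain ⟨a', ha', b', hb', hab'⟩ := hO' t ht
  refine ⟨![b', a'], fun i => ?_, by rw [altProd_two]; exact hab'⟩
  fin_cases i
  exacts [hb', ha']
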